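/- Let $D$ be the open unit disk of $\mathbb C$, $dA$ the normalized area measure on $D$, and $\varphi_a(z)=\frac{a-z}{1-\bar a z}$ for $a\in D$. For an arc $I\subset\partial D$ let $|I|\in(0,1]$ be its normalized length (so $|\partial D|=1$) and let $S(I)=\{z: 1-|I|<|z|<1,\ z/|z|\in I\}$ be its Carleson box. Let $s>0$ and $p>0$ satisfy $s+p>1$, and let $\mu$ be a nonnegative Borel measure on $D$ that is finite on compact subsets of $D$. Let $F(p,p-2,s)$ be the space of all analytic functions $f$ on $D$ with $$\|f\|_{F(p,p-2,s)}^p=\sup_{a\in D}\int_D|f'(z)|^p(1-|z|^2)^{p-2}(1-|\varphi_a(z)|^2)^s\,dA(z)<\infty,$$ equipped with the (quasi-)norm $|f(0)|+\|f\|_{F(p,p-2,s)}$, and let $T^\infty_{p,s}(\mu)$ be the space of all $\mu$-measurable functions $f$ on $D$ with $$\|f\|_{T^\infty_{p,s}(\mu)}^p=\sup_{I\subset\partial D}|I|^{-s}\int_{S(I)}|f(z)|^p\,d\mu(z)<\infty.$$ Suppose that the point evaluations are bounded on (the analytic functions in) $T^\infty_{p,s}(\mu)$, i.e. for each $z\in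 D$ there is a constant $C_z$ such that $|f(z)|\le C_z\|f\|_{T^\infty_{p,s}(\mu)}$ for all analytic $f\in T^\infty_{p,s}(\mu)$. Then the identity operator $I:F(p,p-2,s)\to T^\infty_{p,s}(\mu)$ is (well defined and) compact, i.e. $F(p,p-2,s)\subset T^\infty_{p,s}(\mu)$ and every bounded sequence in $F(p,p-2,s)$ has a subsequence that converges in $T^\infty_{p,s}(\mu)$, if and only if $\mu$ is a vanishing $(p,s)$-logarithmic Carleson measure, i.e. $$\lim_{|I|\to0}\frac1{|I|^s}\Big(\log\frac2{|I|}\Big)^p\mu(S(I))=0.$$ -/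

import Mathlib

open MeasureTheory Set Filter Topology
open scoped ENNReal NNReal

noncomputable section

/-- The open unit disk `D` of the complex plane. -/
def unitDisk : Set ℂ := Metric.ball (0 : ℂ) 1

/-- The normalized area measure `dA` (so that the unit disk has measure `1`). -/
def areaMeasure : Measure ℂ := ENNReal.ofReal (Real.pi⁻¹) • volume

/-- The Möbius transformation `φ_a(z) = (a - z) / (1 - conj a * z)`. -/
def moebius (a z : ℂ) : ℂ := (a - z) / (1 - (starRingEnd ℂ) a * z)

/-- The seminorm
`‖f‖_{F(p,q,s)} = (sup_{a ∈ D} ∫_D |f'|^p (1 - |z|²)^q (1 - |φ_a(z)|²)^s dA(z))^{1/p}`,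
with values in `[0, ∞]`. -/
def fSeminorm (p q s : ℝ) (f : ℂ → ℂ) : ℝ≥0∞ :=
  (⨆ a ∈ unitDisk, ∫⁻ z in unitDisk,
    ‖deriv f z‖ₑ ^ p *
      ENNReal.ofReal ((1 - ‖z‖ ^ 2) ^ q * (1 - ‖moebius a z‖ ^ 2) ^ s) ∂areaMeasure) ^ (1 / p)

/-- The full (quasi-)norm `|f(0)| + ‖f‖_{F(p,q,s)}`, with values in `[0, ∞]`. -/
def fNorm (p q s : ℝ) (f : ℂ → ℂ) : ℝ≥0∞ := ‖f 0‖ₑ + fSeminorm p q s f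

/-- The space `F(p,q,s)`: the functions analytic on the disk with finite `F(p,q,s)` seminorm.
Only the values of the function on the disk matter. -/
def fSpace (p q s : ℝ) : Set (ℂ → ℂ) :=
  {f | DifferentiableOn ℂ f unitDisk ∧ fSeminorm p q s f < ∞}

/-- The closed arc of the unit circle that starts at `e^{iθ}` and has normalized length `h`,
for `0 < h ≤ 1`; for `h = 1` it is the whole circle. -/
def circleArc (θ h : ℝ) : Set ℂ :=
  (fun t : ℝ => Complex.exp (t * Complex.I)) '' Icc θ (θ + 2 * Real.pi * h)

/-- The Carleson box `S(I) = {z : 1 - |I| < |z| < 1, z / |z| ∈ I}` over the arc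
`I = circleArc θ h`, where `|I| = h`. -/
def carlesonBox (θ h : ℝ) : Set ℂ :=
  {z | 1 - h < ‖z‖ ∧ ‖z‖ < 1 ∧ z / (‖z‖ : ℂ) ∈ circleArc θ h}

/-- The tent (quasi-)norm
`‖f‖_{T^∞_{p,s}(μ)} = (sup_I |I|^{-s} ∫_{S(I)} |f|^p dμ)^{1/p}`, with values in `[0, ∞]`;
the supremum is over all arcs `I` with `0 < |I| ≤ 1` (closed arcs suffice, because an arc and its
closure have the same length). -/
def tentNorm (p s : ℝ) (μ : Measure ℂ) (f : ℂ → ℂ) : ℝ≥0∞ :=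
  (⨆ (θ : ℝ) (h ∈ Ioc (0 : ℝ) 1),
    ENNReal.ofReal (h ^ (-s)) * ∫⁻ z in carlesonBox θ h, ‖f z‖ₑ ^ p ∂μ) ^ (1 / p)

/-- The space `T^∞_{p,s}(μ)` of all `μ`-measurable functions with finite tent norm
(for a measure `μ` that is carried by the disk). -/
def tentSpace (p s : ℝ) (μ : Measure ℂ) : Set (ℂ → ℂ) :=
  {f | AEMeasurable f μ ∧ tentNorm p s μ f < ∞}

/-- Point evaluations are bounded functionals on (the analytic functions in) `T^∞_{p,s}(μ)`:
for every `z ∈ D` there is a constant `C` with `|f(z)| ≤ C ‖f‖`. -/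
def PointEvaluationsBounded (p s : ℝ) (μ : Measure ℂ) : Prop :=
  ∀ z ∈ unitDisk, ∃ C : ℝ≥0, ∀ f ∈ tentSpace p s μ, DifferentiableOn ℂ f unitDisk →
    ‖f z‖ₑ ≤ C * tentNorm p s μ f

/-- The identity `I : F(p,q,s) → T^∞_{p,s}(μ)` is a (well defined and) compact operator: it maps
`F(p,q,s)` into `T^∞_{p,s}(μ)`, and every bounded sequence of `F(p,q,s)` has a subsequence that
converges in `T^∞_{p,s}(μ)`. -/
def IsCompactIdentity (p q s : ℝ) (μ : Measure ℂ) : Prop :=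
  fSpace p q s ⊆ tentSpace p s μ ∧
  ∀ f : ℕ → ℂ → ℂ, (∀ n, f n ∈ fSpace p q s) →
    (∃ M : ℝ≥0, ∀ n, fNorm p q s (f n) ≤ M) →
    ∃ g ∈ tentSpace p s μ, ∃ k : ℕ → ℕ, StrictMono k ∧
      Tendsto (fun n => tentNorm p s μ (fun z => f (k n) z - g z)) atTop (𝓝 0)

/-- `μ` is a vanishing `(p,s)`-logarithmic Carleson measure:
`|I|^{-s} (log (2 / |I|))^p μ(S(I)) → 0` as `|I| → 0`, uniformly over the arcs of length `|I|`. -/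
def IsVanishingLogCarleson (p s : ℝ) (μ : Measure ℂ) : Prop :=
  Tendsto (fun h : ℝ => ⨆ θ : ℝ,
    ENNReal.ofReal (h ^ (-s) * Real.log (2 / h) ^ p) * μ (carlesonBox θ h)) (𝓝[>] 0) (𝓝 0)

end

/-! Sufficiency rests on a quantitative embedding, `exists_carleson_embedding`: the tent integrals
of `f` are controlled by the logarithmic Carleson constant of the measure times the energy of `f`
plus `‖f 0‖ ^ p`. For `z` in a box of side `h`, with radial projection `ζ`, write `f z` as `f ((1 -
h) ζ)` plus increments over the dyadic shells of size `d = h / 2 ^ j`. The first term is at most of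
order `log (2 / h)`, because functions in the space are Bloch functions, and the logarithm in the
Carleson condition absorbs it. The `p`-th power of the `j`-th increment is at most `d ^ (p - 2)`
times a local area integral of `|f'| ^ p`, by subharmonicity of `|f'| ^ p`. Raising the sum of
increments to the power `p` costs a weight `(j + 1) ^ p`. After Tonelli the measure enters through
the mass of about one box of side `d`, at most a multiple of `d ^ s * log (2 / d) ^ (-p)`, and since
`log (2 / d) ≥ (j + 1) log 2` the logarithm pays for that weight. What remains is the integral of
`|f'| ^ p (1 - |w|) ^ (p - 2 + s)` near the arc, which the energy bounds by a multiple of `h ^ s`.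
If the measure is vanishing, its restriction to a thin annulus near the circle has small constant,
while on the remaining compact disk a subsequence given by Montel's theorem converges uniformly. By
Fatou the limit keeps the energy bound, so the embedding applied to differences gives convergence in
the tent space. For necessity, suppose that boxes with side `h` tending to zero violate the
condition, and put `b = (1 - h) e^{iθ}`. The functions `log (1 - conj b * z) ^ 2 / log (2 / h)` have
derivatives bounded by a multiple of `1 / |1 - conj b * z|`; a Forelli–Rudin estimate
(`exists_energyLE_of_deriv_le`) bounds their energies uniformly. They tend to zero pointwise, so
Fatou makes any tent limit vanish almost everywhere on the punctured disk, yet on their own boxes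
they are at least `log (2 / h) / 4`. This contradicts convergence of a subsequence. -/

/-! ### Subharmonicity of powers of the modulus, for every positive exponent. -/

lemma Real.exp_one_mul_log_le_rpow {t p : ℝ} (ht : 0 ≤ t) (hp : 0 < p) :
    Real.exp 1 * p * Real.log t ≤ t ^ p := by
  rcases ht.eq_or_lt with rfl | ht
  · simp [Real.zero_rpow hp.ne']
  · have hx : 0 < t ^ p := Real.rpow_pos_of_pos ht p
    have h1 := Real.add_one_le_exp (Real.log (t ^ p) - 1)
    rw [Real.exp_sub, Real.exp_log hx, sub_add_cancel, le_div_iff₀ (Real.exp_pos 1),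
      Real.log_rpow ht] at h1
    linarith

/-- Powers of the modulus of an analytic function are subharmonic: circle version. -/
lemma norm_rpow_le_circleAverage {g : ℂ → ℂ} {c : ℂ} {r p : ℝ} (hr : 0 < r) (hp : 0 < p)
    (hg : AnalyticOnNhd ℂ g (Metric.closedBall c r)) :
    ‖g c‖ ^ p ≤ Real.circleAverage (fun z => ‖g z‖ ^ p) c r := by
  by_cases hgc : g c = 0
  · rw [hgc, norm_zero, Real.zero_rpow hp.ne']
    exact Real.circleAverage_nonneg_of_nonneg fun z _ => by positivity
  have hcont : ContinuousOn g (Metric.closedBall c r) := hg.continuousOn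
  have hm : 0 < ‖g c‖ := norm_pos_iff.mpr hgc
  -- The inequality `e p log t ≤ t ^ p` is an equality exactly at `t = e ^ (1 / p)`. Scaling `g` so
  -- that the modulus at the centre has this value makes the passage from `log` to the power
  -- lossless.
  set K : ℝ := Real.exp (1 / p) / ‖g c‖ with hK
  have hKpos : 0 < K := by positivity
  set G : ℂ → ℂ := fun z => (K : ℂ) * g z with hG
  have hGan : AnalyticOnNhd ℂ G (Metric.closedBall c |r|) := by
    rw [abs_of_pos hr]
    exact analyticOnNhd_const.mul hg
  have hnG : ∀ z, ‖G z‖ = K * ‖g z‖ := fun z => by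
    simp [hG, abs_of_pos hKpos]
  have hGc : ‖G c‖ = Real.exp (1 / p) := by
    rw [hnG, hK]; field_simp
  have hGc0 : G c ≠ 0 := norm_pos_iff.mp (by rw [hGc]; positivity)
  -- Jensen's formula: the excess of the mean over the central value is a sum of `log (r / |c - u|)
  -- ≥ 0` over the zeros `u`.
  have hlog : Real.log ‖G c‖ ≤ Real.circleAverage (Real.log ‖G ·‖) c r := by
    rw [hGan.circleAverage_log_norm hr.ne' hGc0]
    refine le_add_of_nonneg_left (finsum_nonneg fun u => ?_)
    by_cases hu : u ∈ Metric.closedBall c |r|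
    · have h0 : 0 ≤ (MeromorphicOn.divisor G (Metric.closedBall c |r|)) u :=
        (MeromorphicOn.AnalyticOnNhd.divisor_nonneg hGan) u
      refine mul_nonneg (by exact_mod_cast h0) ?_
      by_cases huc : c = u
      · simp [huc]
      rw [← div_eq_mul_inv]
      have hd : 0 < ‖c - u‖ := norm_pos_iff.mpr (sub_ne_zero.mpr huc)
      refine Real.log_nonneg ((one_le_div hd).mpr ?_)
      rw [abs_of_pos hr, Metric.mem_closedBall, dist_comm, dist_eq_norm] at hu
      exact hu
    · simp [hu]
  have hint1 : CircleIntegrable (Real.log ‖G ·‖) c r :=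
    MeromorphicOn.circleIntegrable_log_norm fun z hz =>
      (hGan z (Metric.sphere_subset_closedBall hz)).meromorphicAt
  have hint2 : CircleIntegrable (fun z => ‖g z‖ ^ p) c r := by
    refine ContinuousOn.circleIntegrable hr.le ?_
    exact (hcont.mono Metric.sphere_subset_closedBall).norm.rpow_const fun _ _ => Or.inr hp.le
  have hmono : Real.circleAverage (fun z => (Real.exp 1 * p) • Real.log ‖G z‖) c r ≤
      Real.circleAverage (fun z => (K ^ p) • ‖g z‖ ^ p) c r := by
    refine Real.circleAverage_mono (hint1.const_fun_smul) (hint2.const_fun_smul) fun z _ => ?_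
    have := Real.exp_one_mul_log_le_rpow (norm_nonneg (G z)) hp
    rwa [hnG, Real.mul_rpow hKpos.le (norm_nonneg _), ← hnG] at this
  rw [Real.circleAverage_fun_smul, Real.circleAverage_fun_smul, smul_eq_mul, smul_eq_mul] at hmono
  rw [hGc, Real.log_exp] at hlog
  have h2 : Real.exp 1 ≤ K ^ p * Real.circleAverage (fun z => ‖g z‖ ^ p) c r := by
    refine le_trans ?_ hmono
    have := mul_le_mul_of_nonneg_left hlog (by positivity : (0:ℝ) ≤ Real.exp 1 * p)
    rwa [mul_assoc, mul_one_div_cancel hp.ne', mul_one] at this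
  have h3 : K ^ p = Real.exp 1 / ‖g c‖ ^ p := by
    rw [hK, Real.div_rpow (Real.exp_pos _).le hm.le, ← Real.exp_mul, one_div_mul_cancel hp.ne']
  rw [h3, div_mul_eq_mul_div, le_div_iff₀ (by positivity)] at h2
  exact le_of_mul_le_mul_left h2 (Real.exp_pos 1)

lemma two_pi_mul_enorm_rpow_le_lintegral {g : ℂ → ℂ} {r p : ℝ} (hr : 0 < r) (hp : 0 < p)
    (hg : AnalyticOnNhd ℂ g (Metric.closedBall 0 r)) :
    ENNReal.ofReal (2 * Real.pi) * ‖g 0‖ₑ ^ p ≤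
      ∫⁻ t in Ioo (-Real.pi) Real.pi, ‖g (circleMap 0 r t)‖ₑ ^ p := by
  have h := norm_rpow_le_circleAverage hr hp hg
  rw [Real.circleAverage_eq_integral_add (-Real.pi),
    intervalIntegral.integral_comp_add_right (fun t => ‖g (circleMap 0 r t)‖ ^ p),
    smul_eq_mul, ← div_eq_inv_mul, le_div_iff₀ (by positivity), zero_add,
    show 2 * Real.pi + -Real.pi = Real.pi by ring,
    intervalIntegral.integral_of_le (by linarith [Real.pi_pos]), integral_Ioc_eq_integral_Ioo] at h
  have hc : Continuous fun t => ‖g (circleMap 0 r t)‖ ^ p := by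
    refine Continuous.rpow_const ?_ fun _ => Or.inr hp.le
    refine (hg.continuousOn.comp_continuous (continuous_circleMap 0 r) fun t => ?_).norm
    exact Metric.sphere_subset_closedBall (circleMap_mem_sphere 0 hr.le t)
  have hi : IntegrableOn (fun t => ‖g (circleMap 0 r t)‖ ^ p) (Ioo (-Real.pi) Real.pi) :=
    (hc.integrableOn_Icc).mono_set Ioo_subset_Icc_self
  have h2 := ENNReal.ofReal_le_ofReal h
  rw [ofReal_integral_eq_lintegral_ofReal hi (ae_of_all _ fun t => by positivity)] at h2
  have e : ∀ w : ℂ, ENNReal.ofReal (‖w‖ ^ p) = ‖w‖ₑ ^ p := fun w => by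
    rw [← ENNReal.ofReal_rpow_of_nonneg (norm_nonneg _) hp.le, ofReal_norm]
  rw [ENNReal.ofReal_mul (by positivity)] at h2
  simp_rw [e] at h2
  rwa [mul_comm]

/-- Powers of the modulus of an analytic function are subharmonic: area version. -/
lemma ofReal_mul_enorm_rpow_le_lintegral_ball {g : ℂ → ℂ} {c : ℂ} {R p : ℝ} (hR : 0 < R)
    (hp : 0 < p) (hgm : Measurable g) (hg : DifferentiableOn ℂ g (Metric.ball c R)) :
    ENNReal.ofReal (Real.pi * R ^ 2) * ‖g c‖ₑ ^ p ≤ ∫⁻ z in Metric.ball c R, ‖g z‖ₑ ^ p := by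
  set G : ℂ → ℂ := fun z => g (c + z) with hG
  have hGm : Measurable G := hgm.comp (measurable_const_add c)
  have hGd : DifferentiableOn ℂ G (Metric.ball 0 R) := by
    refine hg.comp (by fun_prop) fun z hz => ?_
    simpa [dist_eq_norm] using hz
  have hshift : ∫⁻ z in Metric.ball c R, ‖g z‖ₑ ^ p = ∫⁻ z in Metric.ball 0 R, ‖G z‖ₑ ^ p := by
    rw [← lintegral_indicator Metric.isOpen_ball.measurableSet,
      ← lintegral_indicator Metric.isOpen_ball.measurableSet,
      ← lintegral_add_left_eq_self _ c]
    refine lintegral_congr fun z => ?_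
    by_cases hz : z ∈ Metric.ball (0 : ℂ) R
    · rw [indicator_of_mem hz, indicator_of_mem (by simpa [dist_eq_norm] using hz)]
    · rw [indicator_of_notMem hz, indicator_of_notMem (by simpa [dist_eq_norm] using hz)]
  have hGc : g c = G 0 := by simp [hG]
  rw [hshift, hGc, ← lintegral_indicator Metric.isOpen_ball.measurableSet,
    ← Complex.lintegral_comp_polarCoord_symm, polarCoord_target, Measure.volume_eq_prod,
    ← Measure.prod_restrict, lintegral_prod]
  · calc ENNReal.ofReal (Real.pi * R ^ 2) * ‖G 0‖ₑ ^ p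
        = ∫⁻ r in Ioo 0 R, ENNReal.ofReal r * (ENNReal.ofReal (2 * Real.pi) * ‖G 0‖ₑ ^ p) := by
          rw [lintegral_mul_const _ (by fun_prop), ← mul_assoc,
            ← ofReal_integral_eq_lintegral_ofReal, ← integral_Ioc_eq_integral_Ioo,
            ← intervalIntegral.integral_of_le hR.le, integral_id,
            ← ENNReal.ofReal_mul (p := (R ^ 2 - 0 ^ 2) / 2) (by norm_num; positivity)]
          · congr 2; ring
          · exact continuous_id.integrableOn_Icc.mono_set Ioo_subset_Icc_self
          · filter_upwards [ae_restrict_mem measurableSet_Ioo] with r hr using hr.1.le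
      _ ≤ ∫⁻ r in Ioo 0 R, ∫⁻ t in Ioo (-Real.pi) Real.pi, ENNReal.ofReal r •
            (Metric.ball 0 R).indicator (fun z => ‖G z‖ₑ ^ p) (Complex.polarCoord.symm (r, t)) := by
          refine setLIntegral_mono' measurableSet_Ioo fun r hr => ?_
          simp_rw [smul_eq_mul]
          rw [lintegral_const_mul' _ _ ENNReal.ofReal_ne_top]
          gcongr
          have hsub : Metric.closedBall (0 : ℂ) r ⊆ Metric.ball 0 R :=
            Metric.closedBall_subset_ball hr.2
          refine (two_pi_mul_enorm_rpow_le_lintegral hr.1 hp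
            ((hGd.analyticOnNhd Metric.isOpen_ball).mono hsub)).trans (le_of_eq ?_)
          refine lintegral_congr fun t => ?_
          have hmap : Complex.polarCoord.symm (r, t) = circleMap 0 r t := by
            simp [circleMap, Complex.exp_mul_I]
          rw [hmap, indicator_of_mem]
          exact hsub (Metric.sphere_subset_closedBall (circleMap_mem_sphere 0 hr.1.le t))
      _ ≤ _ := lintegral_mono_set Ioo_subset_Ioi_self
  · have h1 : Measurable ((Metric.ball (0:ℂ) R).indicator (fun z => ‖G z‖ₑ ^ p)) :=
      (hGm.enorm.pow_const p).indicator Metric.isOpen_ball.measurableSet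
    have h2 : Measurable fun q : ℝ × ℝ => Complex.polarCoord.symm q := by
      simp only [Complex.polarCoord_symm_apply]
      fun_prop
    refine Measurable.aemeasurable ?_
    exact (by fun_prop : Measurable fun q : ℝ × ℝ => ENNReal.ofReal q.1).smul (h1.comp h2)

/-! ### The Möbius weight, the energy integrals and Bloch growth. -/

lemma mem_unitDisk {z : ℂ} : z ∈ unitDisk ↔ ‖z‖ < 1 := by simp [unitDisk]

lemma isOpen_unitDisk : IsOpen unitDisk := Metric.isOpen_ball

lemma measurableSet_unitDisk : MeasurableSet unitDisk := isOpen_unitDisk.measurableSet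

/-- Two-sided comparability makes the sign of the exponent irrelevant, as needed for `p - 2` and `p
- 2 + s`. -/
lemma Real.rpow_le_mul_rpow_of_comparable {x y K : ℝ} (q : ℝ) (hx : 0 < x) (hy : 0 < y)
    (hK : 1 ≤ K) (hxy : x ≤ K * y) (hyx : y ≤ K * x) : x ^ q ≤ K ^ |q| * y ^ q := by
  have hK0 : 0 < K := by linarith
  rcases le_total 0 q with hq | hq
  · rw [abs_of_nonneg hq, ← Real.mul_rpow hK0.le hy.le]
    exact Real.rpow_le_rpow hx.le hxy hq
  · rw [abs_of_nonpos hq, Real.rpow_neg hK0.le]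
    have h : (K * x) ^ q ≤ y ^ q := Real.rpow_le_rpow_of_nonpos hy hyx hq
    rw [Real.mul_rpow hK0.le hx.le] at h
    rwa [le_inv_mul_iff₀ (Real.rpow_pos_of_pos hK0 q)]

lemma norm_one_sub_conj_mul_pos {a z : ℂ} (ha : ‖a‖ < 1) (hz : ‖z‖ < 1) :
    0 < ‖1 - (starRingEnd ℂ) a * z‖ := by
  have h1 : ‖(starRingEnd ℂ) a * z‖ < 1 := by
    rw [norm_mul, RCLike.norm_conj]
    exact mul_lt_one_of_nonneg_of_lt_one_left (norm_nonneg _) ha hz.le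
  have h2 := norm_sub_norm_le (1 : ℂ) ((starRingEnd ℂ) a * z)
  rw [norm_one] at h2
  linarith

lemma one_sub_norm_moebius_sq {a z : ℂ} (ha : ‖a‖ < 1) (hz : ‖z‖ < 1) :
    1 - ‖moebius a z‖ ^ 2 =
      (1 - ‖a‖ ^ 2) * (1 - ‖z‖ ^ 2) / ‖1 - (starRingEnd ℂ) a * z‖ ^ 2 := by
  have h := norm_one_sub_conj_mul_pos ha hz
  rw [moebius, norm_div, div_pow, eq_div_iff (by positivity), sub_mul,
    div_mul_cancel₀ _ (by positivity), one_mul]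
  simp only [← Complex.normSq_eq_norm_sq, Complex.normSq_apply, Complex.sub_re, Complex.sub_im,
    Complex.mul_re, Complex.mul_im, Complex.one_re, Complex.one_im, Complex.conj_re,
    Complex.conj_im]
  ring

/-- The weight of the `F(p,p-2,s)` seminorm. -/
noncomputable def fWeight (p s : ℝ) (a z : ℂ) : ℝ :=
  (1 - ‖z‖ ^ 2) ^ (p - 2) * (1 - ‖moebius a z‖ ^ 2) ^ s

/-- Where `|1 - conj a * z|` is of the order of `1 - |a|`, the identity for `1 - |φ_a| ^ 2` shows it
to be at least of the order of `(1 - |z|) / (1 - |a|)`. Hence a single energy integral controls a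
whole region of size `1 - |a|` near `a`. -/
lemma le_fWeight {p s K : ℝ} {a z : ℂ} (hs : 0 < s) (ha : ‖a‖ < 1) (hz : ‖z‖ < 1) (hK : 0 < K)
    (h : ‖1 - (starRingEnd ℂ) a * z‖ ≤ K * (1 - ‖a‖)) :
    (2 ^ |p - 2|)⁻¹ * (K ^ 2) ^ (-s) * (1 - ‖a‖) ^ (-s) * (1 - ‖z‖) ^ (p - 2 + s) ≤
      fWeight p s a z := by
  have ha0 : 0 < 1 - ‖a‖ := by linarith
  have hz0 : 0 < 1 - ‖z‖ := by linarith
  have hn := norm_nonneg z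
  have hna := norm_nonneg a
  have h1 : (1 - ‖z‖) ^ (p - 2) ≤ 2 ^ |p - 2| * (1 - ‖z‖ ^ 2) ^ (p - 2) :=
    Real.rpow_le_mul_rpow_of_comparable _ hz0 (by nlinarith) (by norm_num) (by nlinarith)
      (by nlinarith)
  have h2 : (1 - ‖z‖) / (K ^ 2 * (1 - ‖a‖)) ≤ 1 - ‖moebius a z‖ ^ 2 := by
    have hpos := norm_one_sub_conj_mul_pos ha hz
    rw [one_sub_norm_moebius_sq ha hz, div_le_div_iff₀ (by positivity) (by positivity)]
    calc (1 - ‖z‖) * ‖1 - (starRingEnd ℂ) a * z‖ ^ 2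
        ≤ (1 - ‖z‖) * (K * (1 - ‖a‖)) ^ 2 := by gcongr
      _ = ((1 - ‖a‖) * (1 - ‖z‖)) * (K ^ 2 * (1 - ‖a‖)) := by ring
      _ ≤ _ := by
        gcongr ?_ * _
        have e1 : 1 - ‖a‖ ≤ 1 - ‖a‖ ^ 2 := by nlinarith
        have e2 : 1 - ‖z‖ ≤ 1 - ‖z‖ ^ 2 := by nlinarith
        exact mul_le_mul e1 e2 hz0.le (by nlinarith)
  have h3 : (K ^ 2) ^ (-s) * (1 - ‖a‖) ^ (-s) * (1 - ‖z‖) ^ s ≤ (1 - ‖moebius a z‖ ^ 2) ^ s := by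
    refine le_trans (le_of_eq ?_) (Real.rpow_le_rpow (by positivity) h2 hs.le)
    rw [Real.div_rpow hz0.le (by positivity), Real.mul_rpow (by positivity) ha0.le,
      Real.rpow_neg (by positivity), Real.rpow_neg ha0.le]
    field_simp
  have h1' : (2 ^ |p - 2|)⁻¹ * (1 - ‖z‖) ^ (p - 2) ≤ (1 - ‖z‖ ^ 2) ^ (p - 2) := by
    rwa [inv_mul_le_iff₀ (by positivity)]
  rw [fWeight]
  refine le_trans (le_of_eq ?_) (mul_le_mul h1' h3 (by positivity) ?_)
  · rw [Real.rpow_add hz0]; ring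
  · exact Real.rpow_nonneg (by nlinarith) _

/-- The energy integrals defining the `F(p,p-2,s)` seminorm of `f` are all at most `E`. -/
def EnergyLE (p s : ℝ) (f : ℂ → ℂ) (E : ℝ≥0∞) : Prop :=
  ∀ a ∈ unitDisk, ∫⁻ z in unitDisk, ‖deriv f z‖ₑ ^ p * ENNReal.ofReal (fWeight p s a z)
    ∂areaMeasure ≤ E

lemma energyLE_of_fSeminorm_le {p s : ℝ} {f : ℂ → ℂ} {M : ℝ≥0∞} (hp : 0 < p)
    (h : fSeminorm p (p - 2) s f ≤ M) : EnergyLE p s f (M ^ p) := by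
  intro a ha
  rw [fSeminorm, one_div, ENNReal.rpow_inv_le_iff hp] at h
  exact (le_iSup₂ (f := fun a (_ : a ∈ unitDisk) => ∫⁻ z in unitDisk, ‖deriv f z‖ₑ ^ p *
    ENNReal.ofReal (fWeight p s a z) ∂areaMeasure) a ha).trans h

lemma EnergyLE.fSeminorm_le {p s : ℝ} {f : ℂ → ℂ} {E : ℝ≥0∞} (hp : 0 < p)
    (h : EnergyLE p s f E) : fSeminorm p (p - 2) s f ≤ E ^ (1 / p) := by
  rw [fSeminorm]
  exact ENNReal.rpow_le_rpow (iSup₂_le h) (by positivity)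

lemma EnergyLE.setLIntegral_le {p s c : ℝ} {f : ℂ → ℂ} {E : ℝ≥0∞} (h : EnergyLE p s f E)
    {a : ℂ} (ha : ‖a‖ < 1) {S : Set ℂ} (hS : MeasurableSet S) (hSD : S ⊆ unitDisk)
    {w : ℂ → ℝ} (hw : ∀ z ∈ S, c * w z ≤ fWeight p s a z) (hc : 0 < c) :
    ∫⁻ z in S, ‖deriv f z‖ₑ ^ p * ENNReal.ofReal (w z) ≤ ENNReal.ofReal (Real.pi / c) * E := by
  have h1 : ∫⁻ z in S, ‖deriv f z‖ₑ ^ p * ENNReal.ofReal (fWeight p s a z) ≤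
      ENNReal.ofReal Real.pi * E := by
    have h2 := h a (mem_unitDisk.mpr ha)
    rw [areaMeasure, Measure.restrict_smul, lintegral_smul_measure, smul_eq_mul,
      ENNReal.ofReal_inv_of_pos Real.pi_pos, ENNReal.inv_mul_le_iff (by simp [Real.pi_pos])
      (by simp)] at h2
    exact (lintegral_mono_set hSD).trans h2
  calc ∫⁻ z in S, ‖deriv f z‖ₑ ^ p * ENNReal.ofReal (w z)
      ≤ ∫⁻ z in S, ENNReal.ofReal c⁻¹ *
          (‖deriv f z‖ₑ ^ p * ENNReal.ofReal (fWeight p s a z)) := by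
        refine setLIntegral_mono' hS fun z hz => ?_
        rw [mul_left_comm, ← ENNReal.ofReal_mul (by positivity)]
        gcongr
        rw [le_inv_mul_iff₀ hc]
        exact hw z hz
    _ = ENNReal.ofReal c⁻¹ * ∫⁻ z in S, ‖deriv f z‖ₑ ^ p * ENNReal.ofReal (fWeight p s a z) :=
        lintegral_const_mul' _ _ ENNReal.ofReal_ne_top
    _ ≤ ENNReal.ofReal c⁻¹ * (ENNReal.ofReal Real.pi * E) := by gcongr
    _ = _ := by
        rw [← mul_assoc, ← ENNReal.ofReal_mul (by positivity), mul_comm c⁻¹, div_eq_mul_inv]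

/-- Functions in `F(p,p-2,s)` are Bloch functions. -/
lemma exists_bloch_bound (p s : ℝ) (hp : 0 < p) (hs : 0 < s) : ∃ C : ℝ, 0 < C ∧
    ∀ (f : ℂ → ℂ) (E : ℝ≥0), DifferentiableOn ℂ f unitDisk → EnergyLE p s f E →
      ∀ a : ℂ, ‖a‖ < 1 → ‖deriv f a‖ ≤ C * (E : ℝ) ^ (1 / p) / (1 - ‖a‖) := by
  set c : ℝ := (2 ^ |p - 2|)⁻¹ * ((3 : ℝ) ^ 2) ^ (-s) * (2 ^ |p - 2 + s|)⁻¹ with hc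
  have hcpos : 0 < c := by positivity
  refine ⟨(4 / c) ^ (1 / p), by positivity, fun f E hf hE a ha => ?_⟩
  set d := 1 - ‖a‖ with hd
  have hd0 : 0 < d := by linarith
  have hball : ∀ z ∈ Metric.ball a (d / 2), d / 2 < 1 - ‖z‖ ∧ 1 - ‖z‖ < 3 / 2 * d ∧
      ‖a - z‖ < d / 2 := fun z hz => by
    rw [Metric.mem_ball, dist_comm, dist_eq_norm] at hz
    have h1 := norm_sub_norm_le a z
    have h2 := norm_sub_norm_le z a
    rw [norm_sub_rev] at h2
    exact ⟨by linarith, by linarith, hz⟩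
  have hsub : Metric.ball a (d / 2) ⊆ unitDisk := fun z hz => by
    rw [mem_unitDisk]; linarith [(hball z hz).1]
  -- The centre of the disk also serves as the Möbius parameter, so on this disk the weight is at
  -- least a constant times `d ^ (-s) * d ^ (p - 2 + s) = d ^ (p - 2)`. The area of the disk
  -- supplies the missing `d ^ 2`.
  have key := hE.setLIntegral_le (c := c) (w := fun _ => d ^ (p - 2)) ha
    Metric.isOpen_ball.measurableSet hsub (fun z hz => ?_) hcpos
  · rw [lintegral_mul_const' _ _ ENNReal.ofReal_ne_top] at key
    have h1 := ofReal_mul_enorm_rpow_le_lintegral_ball (c := a) (half_pos hd0) hp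
      (measurable_deriv f) ((hf.deriv isOpen_unitDisk).mono hsub)
    have h2 := (mul_le_mul_left h1 (ENNReal.ofReal (d ^ (p - 2)))).trans key
    have e : ‖deriv f a‖ₑ ^ p = ENNReal.ofReal (‖deriv f a‖ ^ p) := by
      rw [← ENNReal.ofReal_rpow_of_nonneg (norm_nonneg _) hp.le, ofReal_norm]
    rw [e, ← ENNReal.ofReal_mul (by positivity), ← ENNReal.ofReal_mul (by positivity),
      ← ENNReal.ofReal_coe_nnreal, ← ENNReal.ofReal_mul (by positivity),
      ENNReal.ofReal_le_ofReal_iff (by positivity)] at h2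
    have h3 : (‖deriv f a‖ * d) ^ p ≤ 4 / c * E := by
      rw [Real.mul_rpow (norm_nonneg _) hd0.le]
      have e2 : d ^ p = d ^ (p - 2) * d ^ 2 := by
        rw [← Real.rpow_natCast d 2, ← Real.rpow_add hd0]; norm_num
      rw [e2]
      have hpi := Real.pi_pos
      refine le_of_mul_le_mul_left ?_ (by positivity : 0 < Real.pi / 4)
      calc _ = Real.pi * (d / 2) ^ 2 * ‖deriv f a‖ ^ p * d ^ (p - 2) := by ring
        _ ≤ _ := h2
        _ = _ := by ring
    rw [le_div_iff₀ hd0, ← Real.mul_rpow (by positivity) (by positivity)]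
    calc ‖deriv f a‖ * d = ((‖deriv f a‖ * d) ^ p) ^ (1 / p) := by
          rw [one_div, Real.rpow_rpow_inv (by positivity) hp.ne']
      _ ≤ _ := Real.rpow_le_rpow (by positivity) h3 (by positivity)
  · obtain ⟨h1, h2, h3⟩ := hball z hz
    have hz1 : ‖z‖ < 1 := mem_unitDisk.mp (hsub hz)
    -- The constant 3 covers `1 - |a| ^ 2 ≤ 2 d` together with `|a| |a - z| < d / 2`.
    refine le_trans ?_ (le_fWeight hs ha hz1 (K := 3) (by norm_num) ?_)
    · have h4 : d ^ (p - 2 + s) ≤ 2 ^ |p - 2 + s| * (1 - ‖z‖) ^ (p - 2 + s) :=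
        Real.rpow_le_mul_rpow_of_comparable _ hd0 (by linarith) (by norm_num) (by linarith)
          (by linarith)
      rw [hc, show d ^ (p - 2) = d ^ (-s) * d ^ (p - 2 + s) by
        rw [← Real.rpow_add hd0]; ring_nf]
      calc _ = (2 ^ |p - 2|)⁻¹ * ((3 : ℝ) ^ 2) ^ (-s) * d ^ (-s) *
            ((2 ^ |p - 2 + s|)⁻¹ * d ^ (p - 2 + s)) := by ring
        _ ≤ _ := by
          gcongr
          rwa [inv_mul_le_iff₀ (by positivity)]
    · have e : 1 - (starRingEnd ℂ) a * z =
          ((1 - ‖a‖ ^ 2 : ℝ) : ℂ) + (starRingEnd ℂ) a * (a - z) := by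
        have := Complex.conj_mul' a
        push_cast
        rw [mul_sub, this]; ring
      rw [e]
      refine (norm_add_le _ _).trans ?_
      rw [Complex.norm_real, norm_mul, RCLike.norm_conj, Real.norm_eq_abs,
        abs_of_nonneg (by nlinarith [norm_nonneg a])]
      have := mul_le_mul ha.le h3.le (norm_nonneg _) zero_le_one
      nlinarith [norm_nonneg a]

lemma norm_ofReal_mul_of_norm_eq_one {ζ : ℂ} (hζ : ‖ζ‖ = 1) {r : ℝ} (hr : 0 ≤ r) :
    ‖(r : ℂ) * ζ‖ = r := by simp [hζ, abs_of_nonneg hr]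

lemma hasDerivAt_radial {f : ℂ → ℂ} (hf : DifferentiableOn ℂ f unitDisk) {ζ : ℂ} (hζ : ‖ζ‖ = 1)
    {r : ℝ} (hr : 0 ≤ r) (hr1 : r < 1) :
    HasDerivAt (fun t : ℝ => f ((t : ℂ) * ζ)) (deriv f ((r : ℂ) * ζ) * ζ) r := by
  have hm : (r : ℂ) * ζ ∈ unitDisk := by
    rw [mem_unitDisk, norm_ofReal_mul_of_norm_eq_one hζ hr]; exact hr1
  have h1 := (hf.differentiableAt (isOpen_unitDisk.mem_nhds hm)).hasDerivAt
  have h2 : HasDerivAt (fun t : ℝ => (t : ℂ) * ζ) ζ r := by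
    simpa using (Complex.ofRealCLM.hasDerivAt (x := r)).mul_const ζ
  exact h1.scomp_of_eq r h2 rfl |>.congr_deriv (by simp [mul_comm])

lemma norm_sub_le_of_radial_deriv_le {f : ℂ → ℂ} (hf : DifferentiableOn ℂ f unitDisk) {ζ : ℂ}
    (hζ : ‖ζ‖ = 1) {r₁ r₂ B : ℝ} (h0 : 0 ≤ r₁) (h12 : r₁ ≤ r₂) (h2 : r₂ < 1)
    (hB : ∀ r ∈ Icc r₁ r₂, ‖deriv f ((r : ℂ) * ζ)‖ ≤ B) :
    ‖f ((r₂ : ℂ) * ζ) - f ((r₁ : ℂ) * ζ)‖ ≤ B * (r₂ - r₁) := by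
  refine norm_image_sub_le_of_norm_deriv_le_segment' (f := fun t : ℝ => f ((t : ℂ) * ζ))
    (f' := fun r => deriv f ((r : ℂ) * ζ) * ζ) (fun r hr => ?_) (fun r hr => ?_) r₂
    (right_mem_Icc.mpr h12)
  · exact (hasDerivAt_radial hf hζ (h0.trans hr.1) (hr.2.trans_lt h2)).hasDerivWithinAt
  · rw [norm_mul, hζ, mul_one]
    exact hB r ⟨hr.1, hr.2.le⟩

/-- Along a radius the derivative is dominated by that of `-B log (1 - r)`. -/
lemma norm_le_of_bloch {f : ℂ → ℂ} (hf : DifferentiableOn ℂ f unitDisk) {B : ℝ}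
    (hB : ∀ a : ℂ, ‖a‖ < 1 → ‖deriv f a‖ ≤ B / (1 - ‖a‖)) {z : ℂ} (hz : ‖z‖ < 1) :
    ‖f z‖ ≤ ‖f 0‖ + B * Real.log (1 / (1 - ‖z‖)) := by
  obtain ⟨ζ, hζ, hzζ⟩ : ∃ ζ : ℂ, ‖ζ‖ = 1 ∧ z = (‖z‖ : ℂ) * ζ := by
    by_cases h : z = 0
    · exact ⟨1, by simp, by simp [h]⟩
    · refine ⟨z / ‖z‖, by simp [h], ?_⟩
      have : (‖z‖ : ℂ) ≠ 0 := by simpa using h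
      field_simp
  have key := image_norm_le_of_norm_deriv_right_le_deriv_boundary' (a := 0) (b := ‖z‖)
    (f := fun t : ℝ => f ((t : ℂ) * ζ)) (f' := fun r => deriv f ((r : ℂ) * ζ) * ζ)
    (B := fun r => ‖f 0‖ + B * -Real.log (1 - r)) (B' := fun r => B / (1 - r))
    (fun r hr => (hasDerivAt_radial hf hζ hr.1
      (hr.2.trans_lt hz)).continuousAt.continuousWithinAt)
    (fun r hr => (hasDerivAt_radial hf hζ hr.1 (hr.2.trans hz)).hasDerivWithinAt)
    (by simp) ?_ ?_ ?_ (right_mem_Icc.mpr (norm_nonneg z))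
  · simpa [← hzζ] using key
  · intro r hr
    have : 1 - r ≠ 0 := by linarith [hr.2]
    exact (continuousAt_const.add (continuousAt_const.mul
      ((by fun_prop : ContinuousAt (fun r : ℝ => 1 - r) r).log this).neg)).continuousWithinAt
  · intro r hr
    have : 1 - r ≠ 0 := by linarith [hr.2]
    have h1 : HasDerivAt (fun r : ℝ => 1 - r) (-1) r := by
      simpa using (hasDerivAt_id r).const_sub 1
    refine (((h1.log this).neg.const_mul B).const_add ‖f 0‖).hasDerivWithinAt.congr_deriv ?_
    field_simp
  · intro r hr
    rw [norm_mul, hζ, mul_one]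
    have := norm_ofReal_mul_of_norm_eq_one hζ hr.1
    have h2 := hB (r * ζ) (by rw [this]; linarith [hr.2])
    rwa [this] at h2

/-! ### Logarithmic Carleson constants and the geometry of boxes. -/

/-- `ν` is a `(p,s)`-logarithmic Carleson measure with constant `N`. -/
def LogCarlesonLE (p s : ℝ) (ν : Measure ℂ) (N : ℝ≥0∞) : Prop :=
  ∀ θ : ℝ, ∀ h ∈ Ioc (0 : ℝ) 1,
    ENNReal.ofReal (h ^ (-s) * Real.log (2 / h) ^ p) * ν (carlesonBox θ h) ≤ N

lemma isClosed_circleArc (θ h : ℝ) : IsClosed (circleArc θ h) :=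
  (isCompact_Icc.image (by fun_prop)).isClosed

lemma measurableSet_carlesonBox (θ h : ℝ) : MeasurableSet (carlesonBox θ h) := by
  have h1 : MeasurableSet {z : ℂ | 1 - h < ‖z‖} := measurableSet_lt (by fun_prop) (by fun_prop)
  have h2 : MeasurableSet {z : ℂ | ‖z‖ < 1} := measurableSet_lt (by fun_prop) (by fun_prop)
  have h3 : MeasurableSet {z : ℂ | z / (‖z‖ : ℂ) ∈ circleArc θ h} :=
    (by fun_prop : Measurable fun z : ℂ => z / (‖z‖ : ℂ)) (isClosed_circleArc θ h).measurableSet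
  exact h1.inter (h2.inter h3)

lemma carlesonBox_subset_unitDisk (θ h : ℝ) : carlesonBox θ h ⊆ unitDisk := fun _ hz =>
  mem_unitDisk.mpr hz.2.1

lemma log_two_le_log_two_div {h : ℝ} (h0 : 0 < h) (h1 : h ≤ 1) :
    Real.log 2 ≤ Real.log (2 / h) :=
  Real.log_le_log (by norm_num) (by rw [le_div_iff₀ h0]; linarith)

lemma log_two_div_pos {h : ℝ} (h0 : 0 < h) (h1 : h ≤ 1) : 0 < Real.log (2 / h) :=
  (Real.log_pos (by norm_num)).trans_le (log_two_le_log_two_div h0 h1)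

lemma LogCarlesonLE.measure_le {p s : ℝ} {ν : Measure ℂ} {N : ℝ≥0∞} (H : LogCarlesonLE p s ν N)
    (θ : ℝ) {h : ℝ} (h0 : 0 < h) (h1 : h ≤ 1) :
    ν (carlesonBox θ h) ≤ ENNReal.ofReal (h ^ s * (Real.log (2 / h) ^ p)⁻¹) * N := by
  have hl := log_two_div_pos h0 h1
  have hpos : 0 < h ^ (-s) * Real.log (2 / h) ^ p := by positivity
  have := H θ h ⟨h0, h1⟩
  rw [show h ^ s * (Real.log (2 / h) ^ p)⁻¹ = (h ^ (-s) * Real.log (2 / h) ^ p)⁻¹ by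
    rw [Real.rpow_neg h0.le, mul_inv, inv_inv], ENNReal.ofReal_inv_of_pos hpos]
  rwa [← ENNReal.mul_le_iff_le_inv (by simpa using hpos) ENNReal.ofReal_ne_top]

/-- An arc is the image of a parameter interval, so the parameter `z₀.arg + u` need not be the
principal argument of `z`; this avoids all branch cases. -/
lemma mem_circleArc_of_arg {z : ℂ} (hz : z ≠ 0) {θ h u : ℝ} {z₀ : ℂ} (hz₀ : z₀ ≠ 0)
    (hu : u = ((z / ‖z‖) / (z₀ / ‖z₀‖)).arg) (hmem : z₀.arg + u ∈ Icc θ (θ + 2 * Real.pi * h)) :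
    z / (‖z‖ : ℂ) ∈ circleArc θ h := by
  refine ⟨z₀.arg + u, hmem, ?_⟩
  have hn : (‖z‖ : ℂ) ≠ 0 := by simpa using hz
  have hn₀ : (‖z₀‖ : ℂ) ≠ 0 := by simpa using hz₀
  have e1 : Complex.exp (z₀.arg * Complex.I) = z₀ / ‖z₀‖ := by
    rw [eq_div_iff hn₀, mul_comm, Complex.norm_mul_exp_arg_mul_I]
  have e2 : Complex.exp (u * Complex.I) = (z / ‖z‖) / (z₀ / ‖z₀‖) := by
    have := Complex.norm_mul_exp_arg_mul_I ((z / ‖z‖) / (z₀ / ‖z₀‖))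
    rw [← hu] at this
    simpa [hz, hz₀] using this
  simp only [Complex.ofReal_add, add_mul, Complex.exp_add, e1, e2]
  field_simp

/-- Points near the circle whose radial projection is `2d`-close to a given point lie in the union
of two Carleson boxes of length `d`. -/
lemma exists_subset_carlesonBox_union {d : ℝ} (hd1 : d ≤ 1) (w : ℂ) :
    ∃ t : ℝ, {z : ℂ | 1 - d < ‖z‖ ∧ ‖z‖ < 1 ∧ ‖z / (‖z‖ : ℂ) - w‖ < 2 * d} ⊆
      carlesonBox t d ∪ carlesonBox (t - 2 * Real.pi * d) d := by
  rcases Set.eq_empty_or_nonempty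
    {z : ℂ | 1 - d < ‖z‖ ∧ ‖z‖ < 1 ∧ ‖z / (‖z‖ : ℂ) - w‖ < 2 * d} with h | ⟨z₀, h₀, h₀', h₀''⟩
  · exact ⟨0, by rw [h]; exact empty_subset _⟩
  refine ⟨z₀.arg, fun z ⟨h1, h2, h3⟩ => ?_⟩
  have hz : z ≠ 0 := norm_pos_iff.mp (by linarith)
  have hz₀ : z₀ ≠ 0 := norm_pos_iff.mp (by linarith)
  have hn : ‖z / (‖z‖ : ℂ)‖ = 1 := by simp [hz]
  have hn₀ : ‖z₀ / (‖z₀‖ : ℂ)‖ = 1 := by simp [hz₀]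
  have hang := Complex.angle_le_mul_norm_sub hn hn₀
  rw [Complex.angle_eq_abs_arg (norm_pos_iff.mp (by rw [hn]; norm_num))
    (norm_pos_iff.mp (by rw [hn₀]; norm_num))] at hang
  set u := ((z / (‖z‖ : ℂ)) / (z₀ / (‖z₀‖ : ℂ))).arg with hu
  -- A chord of at most `4 d` subtends an angle of at most `(π / 2) * 4 d = 2 π d`, the full angle
  -- of one arc of normalized length `d`. One box on each side of `z₀` therefore suffices.
  have hdist : ‖z / (‖z‖ : ℂ) - z₀ / (‖z₀‖ : ℂ)‖ ≤ 4 * d := by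
    have := norm_sub_le_norm_sub_add_norm_sub (z / (‖z‖ : ℂ)) w (z₀ / (‖z₀‖ : ℂ))
    rw [norm_sub_rev w] at this
    linarith
  have hu2 : |u| ≤ 2 * Real.pi * d := by
    have := mul_le_mul_of_nonneg_left hdist (by positivity : 0 ≤ Real.pi / 2)
    linarith
  obtain ⟨hu3, hu4⟩ := abs_le.mp hu2
  rcases le_total 0 u with h0 | h0
  · exact Or.inl ⟨h1, h2, mem_circleArc_of_arg hz hz₀ hu ⟨by linarith, by linarith⟩⟩
  · exact Or.inr ⟨h1, h2, mem_circleArc_of_arg hz hz₀ hu ⟨by linarith, by linarith⟩⟩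

lemma LogCarlesonLE.measure_projection_le {p s : ℝ} {ν : Measure ℂ} {N : ℝ≥0∞}
    (H : LogCarlesonLE p s ν N) {d : ℝ} (hd0 : 0 < d) (hd1 : d ≤ 1) (w : ℂ) :
    ν {z : ℂ | 1 - d < ‖z‖ ∧ ‖z‖ < 1 ∧ ‖z / (‖z‖ : ℂ) - w‖ < 2 * d} ≤
      ENNReal.ofReal (d ^ s * (Real.log (2 / d) ^ p)⁻¹) * (2 * N) := by
  obtain ⟨t, ht⟩ := exists_subset_carlesonBox_union hd1 w
  refine (measure_mono ht).trans ((measure_union_le _ _).trans ?_)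
  refine (add_le_add (H.measure_le _ hd0 hd1) (H.measure_le _ hd0 hd1)).trans (le_of_eq ?_)
  ring

lemma norm_exp_sub_exp_le (t θ : ℝ) :
    ‖Complex.exp (t * Complex.I) - Complex.exp (θ * Complex.I)‖ ≤ |t - θ| := by
  have e : Complex.exp (t * Complex.I) - Complex.exp (θ * Complex.I) =
      Complex.exp (θ * Complex.I) * (Complex.exp (Complex.I * ((t - θ : ℝ) : ℂ)) - 1) := by
    rw [mul_sub, ← Complex.exp_add, mul_one]
    congr 2
    push_cast; ring
  rw [e, norm_mul, Complex.norm_exp_ofReal_mul_I, one_mul]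
  exact Real.norm_exp_I_mul_ofReal_sub_one_le

lemma norm_sub_le_of_mem_circleArc {ζ : ℂ} {θ h : ℝ} (hζ : ζ ∈ circleArc θ h) :
    ‖ζ - Complex.exp (θ * Complex.I)‖ ≤ 2 * Real.pi * h := by
  obtain ⟨t, ⟨h1, h2⟩, rfl⟩ := hζ
  refine (norm_exp_sub_exp_le t θ).trans ?_
  rw [abs_of_nonneg (by linarith)]
  linarith

lemma norm_eq_one_of_mem_circleArc {ζ : ℂ} {θ h : ℝ} (hζ : ζ ∈ circleArc θ h) : ‖ζ‖ = 1 := by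
  obtain ⟨t, -, rfl⟩ := hζ
  exact Complex.norm_exp_ofReal_mul_I t

/-! ### Telescoping over dyadic shells. -/

lemma ENNReal.sum_rpow_le_sum_rpow {p : ℝ} (hp : 0 < p) (hp1 : p ≤ 1) (b : ℕ → ℝ≥0∞) (n : ℕ) :
    (∑ j ∈ Finset.range n, b j) ^ p ≤ ∑ j ∈ Finset.range n, b j ^ p := by
  induction n with
  | zero => simp [hp]
  | succ n ih =>
    rw [Finset.sum_range_succ, Finset.sum_range_succ]
    exact (ENNReal.rpow_add_le_add_rpow _ _ hp.le hp1).trans (add_le_add_left ih _)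

/-- For `p ≤ 1` this is subadditivity of the power. For `p > 1` apply Hölder to `b j = (j + 1)⁻¹ *
((j + 1) * b j)`: the conjugate exponent exceeds 1, so the first factors are summable. The logarithm
in the Carleson condition later cancels the weight. -/
lemma ENNReal.exists_sum_rpow_le_weighted {p : ℝ} (hp : 0 < p) : ∃ C : ℝ≥0∞, C ≠ ∞ ∧
    ∀ (b : ℕ → ℝ≥0∞) (n : ℕ), (∑ j ∈ Finset.range n, b j) ^ p ≤
      C * ∑ j ∈ Finset.range n, ENNReal.ofReal (((j : ℝ) + 1) ^ p) * b j ^ p := by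
  rcases le_or_gt p 1 with hp1 | hp1
  · refine ⟨1, one_ne_top, fun b n => ?_⟩
    rw [one_mul]
    refine (sum_rpow_le_sum_rpow hp hp1 b n).trans (Finset.sum_le_sum fun j _ => ?_)
    refine le_mul_of_one_le_left' ?_
    rw [ENNReal.one_le_ofReal]
    exact Real.one_le_rpow (by linarith [(Nat.cast_nonneg j : (0:ℝ) ≤ j)]) hp.le
  · obtain ⟨q, hq⟩ : ∃ q : ℝ, q.HolderConjugate p := ⟨_, (Real.HolderConjugate.conjExponent hp1).symm⟩
    have hsum : Summable fun j : ℕ => (((j : ℝ) + 1)⁻¹) ^ q := by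
      have h1 := (summable_nat_add_iff 1).mpr (Real.summable_nat_rpow_inv.mpr hq.lt)
      refine h1.congr fun j => ?_
      push_cast
      rw [Real.inv_rpow (by positivity)]
    refine ⟨((∑' j : ℕ, ENNReal.ofReal ((((j : ℝ) + 1)⁻¹) ^ q)) ^ (1 / q)) ^ p, ?_, fun b n => ?_⟩
    · refine ENNReal.rpow_ne_top_of_nonneg hp.le (ENNReal.rpow_ne_top_of_nonneg ?_ ?_)
      · exact one_div_nonneg.mpr hq.nonneg
      · exact hsum.tsum_ofReal_ne_top
    · have h1 := ENNReal.inner_le_Lp_mul_Lq (Finset.range n)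
        (fun j : ℕ => ENNReal.ofReal ((j : ℝ) + 1)⁻¹)
        (fun j : ℕ => ENNReal.ofReal ((j : ℝ) + 1) * b j) hq
      have e1 : ∀ j : ℕ, ENNReal.ofReal ((j : ℝ) + 1)⁻¹ * (ENNReal.ofReal ((j : ℝ) + 1) * b j) =
          b j := fun j => by
        rw [← mul_assoc, ← ENNReal.ofReal_mul (by positivity), inv_mul_cancel₀ (by positivity),
          ENNReal.ofReal_one, one_mul]
      simp_rw [e1] at h1
      refine (ENNReal.rpow_le_rpow h1 hp.le).trans ?_
      rw [ENNReal.mul_rpow_of_nonneg _ _ hp.le]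
      refine mul_le_mul' ?_ (le_of_eq ?_)
      · gcongr
        · exact one_div_nonneg.mpr hq.nonneg
        · refine le_trans (Finset.sum_le_sum fun j _ => ?_) (ENNReal.sum_le_tsum (Finset.range n))
          rw [ENNReal.ofReal_rpow_of_nonneg (by positivity) hq.nonneg]
      · rw [one_div, ENNReal.rpow_inv_rpow hp.ne']
        refine Finset.sum_congr rfl fun j _ => ?_
        rw [ENNReal.mul_rpow_of_nonneg _ _ hp.le, ENNReal.ofReal_rpow_of_nonneg (by positivity) hp.le]

lemma enorm_sub_le_of_radial_deriv_le {f : ℂ → ℂ} (hf : DifferentiableOn ℂ f unitDisk) {ζ : ℂ}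
    (hζ : ‖ζ‖ = 1) {r₁ r₂ L : ℝ} {B : ℝ≥0∞} (h0 : 0 ≤ r₁) (h12 : r₁ ≤ r₂) (h2 : r₂ < 1)
    (hL : 0 < L) (hrL : r₂ - r₁ ≤ L)
    (hB : ∀ r ∈ Icc r₁ r₂, ENNReal.ofReal L * ‖deriv f ((r : ℂ) * ζ)‖ₑ ≤ B) :
    ‖f ((r₂ : ℂ) * ζ) - f ((r₁ : ℂ) * ζ)‖ₑ ≤ B := by
  by_cases hBt : B = ∞
  · simp [hBt]
  lift B to ℝ≥0 using hBt
  have h := norm_sub_le_of_radial_deriv_le (B := (B : ℝ) / L) hf hζ h0 h12 h2 fun r hr => by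
    have := hB r hr
    rw [← ofReal_norm, ← ENNReal.ofReal_mul hL.le, ← ENNReal.ofReal_coe_nnreal,
      ENNReal.ofReal_le_ofReal_iff B.coe_nonneg] at this
    rw [le_div_iff₀ hL]
    linarith
  rw [← ofReal_norm, ← ENNReal.ofReal_coe_nnreal]
  refine ENNReal.ofReal_le_ofReal (h.trans ?_)
  rw [div_mul_eq_mul_div, div_le_iff₀ hL]
  exact mul_le_mul_of_nonneg_left hrL B.coe_nonneg

/-- Telescoping along a radius over dyadic shells. -/
lemma exists_enorm_le_add_sum {f : ℂ → ℂ} (hf : DifferentiableOn ℂ f unitDisk) {ζ : ℂ}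
    (hζ : ‖ζ‖ = 1) {h : ℝ} (h0 : 0 < h) (h1 : h ≤ 1) {B : ℕ → ℝ≥0∞}
    (hB : ∀ j : ℕ, ∀ r ∈ Icc (1 - h / 2 ^ j) (1 - h / 2 ^ (j + 1)),
      ENNReal.ofReal (h / 2 ^ j) * ‖deriv f ((r : ℂ) * ζ)‖ₑ ≤ B j)
    {r : ℝ} (hr : 1 - h < r) (hr1 : r < 1) :
    ∃ n : ℕ, (∀ j < n, 1 - h / 2 ^ j < r) ∧
      ‖f ((r : ℂ) * ζ)‖ₑ ≤ ‖f (((1 - h : ℝ) : ℂ) * ζ)‖ₑ + ∑ j ∈ Finset.range n, B j := by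
  have hhalf : ∀ j : ℕ, h / 2 ^ (j + 1) = h / 2 ^ j / 2 := fun j => by rw [pow_succ]; field_simp
  have hdpos : ∀ j : ℕ, 0 < h / 2 ^ j := fun j => by positivity
  have hdle : ∀ j : ℕ, h / 2 ^ j ≤ 1 := fun j =>
    (div_le_self h0.le (one_le_pow₀ (by norm_num))).trans h1
  have step : ∀ n : ℕ, ∀ r ∈ Icc (1 - h / 2 ^ n) (1 - h / 2 ^ (n + 1)),
      ‖f ((r : ℂ) * ζ) - f (((1 - h / 2 ^ n : ℝ) : ℂ) * ζ)‖ₑ ≤ B n := fun n r hr => by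
    refine enorm_sub_le_of_radial_deriv_le hf hζ (by linarith [hdle n]) hr.1
      (by linarith [hr.2, hdpos (n + 1)]) (hdpos n) ?_ fun r' hr' => hB n r' ⟨hr'.1, hr'.2.trans hr.2⟩
    have := hr.2
    rw [hhalf] at this
    linarith [hdpos n]
  have tri : ∀ a b : ℂ, ‖a‖ₑ ≤ ‖b‖ₑ + ‖a - b‖ₑ := fun a b => by
    simpa using enorm_add_le b (a - b)
  have main : ∀ n : ℕ, ‖f (((1 - h / 2 ^ n : ℝ) : ℂ) * ζ)‖ₑ ≤
      ‖f (((1 - h : ℝ) : ℂ) * ζ)‖ₑ + ∑ j ∈ Finset.range n, B j := fun n => by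
    induction n with
    | zero => simp
    | succ n ih =>
      rw [Finset.sum_range_succ, ← add_assoc]
      exact (tri _ _).trans (add_le_add ih (step n _ ⟨by linarith [hhalf n, hdpos n], le_rfl⟩))
  have hex : ∃ n : ℕ, r ≤ 1 - h / 2 ^ (n + 1) := by
    obtain ⟨n, hn⟩ := pow_unbounded_of_one_lt (h / (1 - r)) (one_lt_two)
    refine ⟨n, ?_⟩
    rw [div_lt_iff₀ (by linarith)] at hn
    have : h / 2 ^ n ≤ 1 - r := by rw [div_le_iff₀ (by positivity)]; linarith
    linarith [hhalf n, hdpos n]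
  classical
  set n := Nat.find hex with hn
  have hn1 : r ≤ 1 - h / 2 ^ (n + 1) := Nat.find_spec hex
  have hn2 : 1 - h / 2 ^ n < r := by
    rcases Nat.eq_zero_or_pos n with h' | h'
    · rw [h']; simpa using hr
    · have := Nat.find_min hex (m := n - 1) (by omega)
      rw [Nat.sub_add_cancel h'] at this
      exact not_le.mp this
  -- The shells `0, …, n` are used, the last one being that of `r`. Each begins strictly below `r`,
  -- which is where the mean value bound for that shell is available.
  refine ⟨n + 1, fun j hj => lt_of_le_of_lt ?_ hn2, ?_⟩
  · have : h / 2 ^ n ≤ h / 2 ^ j := by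
      gcongr
      · norm_num
      · omega
    linarith
  · rw [Finset.sum_range_succ, ← add_assoc]
    exact (tri _ _).trans (add_le_add (main n) (step n r ⟨hn2.le, hn1⟩))

/-! ### Shell integrals and Tonelli's theorem. -/

/-- Pairs `(z, w)` such that `w` lies in the dyadic shell of size `d` near the radial projection
of `z`. -/
def shellPairs (d : ℝ) : Set (ℂ × ℂ) :=
  {q | (1 - d < ‖q.1‖ ∧ ‖q.1‖ < 1 ∧ ‖q.1 / (‖q.1‖ : ℂ) - q.2‖ < 2 * d) ∧ d / 4 < 1 - ‖q.2‖}

lemma measurableSet_shellPairs (d : ℝ) : MeasurableSet (shellPairs d) := by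
  have h1 : MeasurableSet {q : ℂ × ℂ | 1 - d < ‖q.1‖} :=
    measurableSet_lt (by fun_prop) (by fun_prop)
  have h2 : MeasurableSet {q : ℂ × ℂ | ‖q.1‖ < 1} := measurableSet_lt (by fun_prop) (by fun_prop)
  have h3 : MeasurableSet {q : ℂ × ℂ | ‖q.1 / (‖q.1‖ : ℂ) - q.2‖ < 2 * d} :=
    measurableSet_lt (by fun_prop) (by fun_prop)
  have h4 : MeasurableSet {q : ℂ × ℂ | d / 4 < 1 - ‖q.2‖} :=
    measurableSet_lt (by fun_prop) (by fun_prop)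
  exact (h1.inter (h2.inter h3)).inter h4

lemma measurableSet_norm_sub_lt (u : ℂ) (r : ℝ) : MeasurableSet {w : ℂ | ‖w - u‖ < r} :=
  measurableSet_lt (by fun_prop) (by fun_prop)

/-- The part of the dyadic shell of size `d` near the arc of length `h` that starts at `θ`. -/
def arcShell (θ h d : ℝ) : Set ℂ :=
  {w | d / 4 < 1 - ‖w‖ ∧ 1 - ‖w‖ < 2 * d ∧ ‖w - Complex.exp (θ * Complex.I)‖ < 9 * h}

lemma measurableSet_arcShell (θ h d : ℝ) : MeasurableSet (arcShell θ h d) := by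
  have h1 : MeasurableSet {w : ℂ | d / 4 < 1 - ‖w‖} := measurableSet_lt (by fun_prop) (by fun_prop)
  have h2 : MeasurableSet {w : ℂ | 1 - ‖w‖ < 2 * d} := measurableSet_lt (by fun_prop) (by fun_prop)
  exact h1.inter (h2.inter (measurableSet_norm_sub_lt _ _))

/-- The disk of radius `d / 4` about the point on the radius lies in the slice of `shellPairs d`
over `z`, so this is the area mean value inequality; `16 / π` comes from the area `π (d / 4) ^ 2`.
-/
lemma deriv_rpow_le_lintegral_shell {p : ℝ} (hp : 0 < p) {f : ℂ → ℂ}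
    (hf : DifferentiableOn ℂ f unitDisk) {d : ℝ} (hd0 : 0 < d) {z : ℂ} (hz0 : z ≠ 0)
    (hzd : 1 - d < ‖z‖) (hz1 : ‖z‖ < 1) {r : ℝ} (hr : r ∈ Icc (1 - d) (1 - d / 2)) (hr0 : 0 ≤ r) :
    (ENNReal.ofReal d * ‖deriv f ((r : ℂ) * (z / (‖z‖ : ℂ)))‖ₑ) ^ p ≤
      ENNReal.ofReal (16 / Real.pi * d ^ (p - 2)) *
        ∫⁻ w, (shellPairs d).indicator (fun q => ‖deriv f q.2‖ₑ ^ p) (z, w) := by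
  set ζ := z / (‖z‖ : ℂ) with hζdef
  have hζ : ‖ζ‖ = 1 := by simp [hζdef, hz0]
  have hball : ∀ w ∈ Metric.ball ((r : ℂ) * ζ) (d / 4), d / 4 < 1 - ‖w‖ ∧ ‖ζ - w‖ < 2 * d := by
    intro w hw
    rw [Metric.mem_ball, dist_eq_norm] at hw
    have h1 := norm_sub_norm_le w ((r : ℂ) * ζ)
    rw [norm_ofReal_mul_of_norm_eq_one hζ hr0] at h1
    have h2 : ‖ζ - (r : ℂ) * ζ‖ = 1 - r := by
      rw [show ζ - (r : ℂ) * ζ = ((1 - r : ℝ) : ℂ) * ζ by push_cast; ring]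
      exact norm_ofReal_mul_of_norm_eq_one hζ (by linarith [hr.2])
    have h3 := norm_sub_le_norm_sub_add_norm_sub ζ ((r : ℂ) * ζ) w
    rw [norm_sub_rev ((r : ℂ) * ζ) w] at h3
    exact ⟨by linarith [hr.2], by linarith [hr.1]⟩
  have hsub : Metric.ball ((r : ℂ) * ζ) (d / 4) ⊆ unitDisk := fun w hw => by
    rw [mem_unitDisk]; linarith [(hball w hw).1]
  have h1 := ofReal_mul_enorm_rpow_le_lintegral_ball (by linarith : 0 < d / 4) hp
    (measurable_deriv f) ((hf.deriv isOpen_unitDisk).mono hsub)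
  have h2 : ∫⁻ w in Metric.ball ((r : ℂ) * ζ) (d / 4), ‖deriv f w‖ₑ ^ p ≤
      ∫⁻ w, (shellPairs d).indicator (fun q => ‖deriv f q.2‖ₑ ^ p) (z, w) := by
    rw [← lintegral_indicator Metric.isOpen_ball.measurableSet]
    refine lintegral_mono fun w => ?_
    by_cases hw : w ∈ Metric.ball ((r : ℂ) * ζ) (d / 4)
    · rw [indicator_of_mem hw, indicator_of_mem]
      exact ⟨⟨hzd, hz1, (hball w hw).2⟩, (hball w hw).1⟩
    · rw [indicator_of_notMem hw]; exact zero_le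
  have hpi := Real.pi_pos
  have e : ENNReal.ofReal d ^ p = ENNReal.ofReal (16 / Real.pi * d ^ (p - 2)) *
      ENNReal.ofReal (Real.pi * (d / 4) ^ 2) := by
    rw [← ENNReal.ofReal_mul (by positivity), ENNReal.ofReal_rpow_of_pos hd0]
    congr 1
    have : d ^ p = d ^ (p - 2) * d ^ 2 := by
      rw [← Real.rpow_natCast d 2, ← Real.rpow_add hd0]; norm_num
    rw [this]
    field_simp
    norm_num
  rw [ENNReal.mul_rpow_of_nonneg _ _ hp.le, e, mul_assoc]
  gcongr
  exact h1.trans h2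

lemma mem_arcShell_of_mem_shellPairs {θ h d : ℝ} (hdh : d ≤ h) {z w : ℂ}
    (hz : z ∈ carlesonBox θ h) (hzw : (z, w) ∈ shellPairs d) : w ∈ arcShell θ h d := by
  obtain ⟨⟨h1, h2, h3⟩, h4⟩ := hzw
  have hζ := norm_eq_one_of_mem_circleArc hz.2.2
  have h5 := norm_sub_le_of_mem_circleArc hz.2.2
  have h6 := norm_sub_norm_le (z / (‖z‖ : ℂ)) w
  have h7 := norm_sub_le_norm_sub_add_norm_sub w (z / (‖z‖ : ℂ)) (Complex.exp (θ * Complex.I))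
  rw [norm_sub_rev w (z / (‖z‖ : ℂ))] at h7
  simp only at h3 h4
  have hh : 0 < h := by linarith [norm_nonneg (z / (‖z‖ : ℂ) - w)]
  refine ⟨h4, by linarith, ?_⟩
  -- The distance is below `2 d + 2 π h`, with `d ≤ h` and `2 + 2 π < 9`.
  nlinarith [Real.pi_lt_d2]

/-- After exchanging the integrals, for fixed `w` the points `z` lie in at most two boxes of side
`d`, whose mass the Carleson constant bounds. -/
lemma LogCarlesonLE.lintegral_shell_le {p s : ℝ} {ν : Measure ℂ} [SFinite ν] {N : ℝ≥0∞}
    (H : LogCarlesonLE p s ν N) (f : ℂ → ℂ) (θ : ℝ) {h d : ℝ} (hd0 : 0 < d) (hdh : d ≤ h)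
    (h1 : h ≤ 1) :
    ∫⁻ z in carlesonBox θ h,
        (∫⁻ w, (shellPairs d).indicator (fun q => ‖deriv f q.2‖ₑ ^ p) (z, w)) ∂ν
      ≤ ENNReal.ofReal (d ^ s * (Real.log (2 / d) ^ p)⁻¹) * (2 * N) *
        ∫⁻ w in arcShell θ h d, ‖deriv f w‖ₑ ^ p := by
  have hm : Measurable ((shellPairs d).indicator (fun q : ℂ × ℂ => ‖deriv f q.2‖ₑ ^ p)) :=
    (((measurable_deriv f).comp measurable_snd).enorm.pow_const p).indicator
      (measurableSet_shellPairs d)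
  rw [lintegral_lintegral_swap (by exact hm.aemeasurable),
    ← lintegral_indicator (measurableSet_arcShell θ h d), ← lintegral_const_mul]
  · refine lintegral_mono fun w => ?_
    have hslice : MeasurableSet {z | (z, w) ∈ shellPairs d} :=
      measurable_prodMk_right (measurableSet_shellPairs d)
    calc ∫⁻ z in carlesonBox θ h, (shellPairs d).indicator (fun q => ‖deriv f q.2‖ₑ ^ p) (z, w) ∂ν
        = ∫⁻ z in carlesonBox θ h, {z | (z, w) ∈ shellPairs d}.indicator
            (fun _ => ‖deriv f w‖ₑ ^ p) z ∂ν := lintegral_congr fun z => by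
          by_cases hz : (z, w) ∈ shellPairs d
          · rw [indicator_of_mem hz, indicator_of_mem (show z ∈ {z | (z, w) ∈ shellPairs d} from hz)]
          · rw [indicator_of_notMem hz,
              indicator_of_notMem (show z ∉ {z | (z, w) ∈ shellPairs d} from hz)]
      _ = ‖deriv f w‖ₑ ^ p * ν ({z | (z, w) ∈ shellPairs d} ∩ carlesonBox θ h) := by
          rw [lintegral_indicator_const hslice, Measure.restrict_apply hslice]
      _ ≤ _ := by
          by_cases hw : w ∈ arcShell θ h d
          · rw [indicator_of_mem hw, mul_comm]
            gcongr
            refine le_trans (measure_mono fun z hz => ?_)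
              (H.measure_projection_le hd0 (hdh.trans h1) w)
            exact hz.1.1
          · rw [indicator_of_notMem hw, mul_zero]
            have : {z | (z, w) ∈ shellPairs d} ∩ carlesonBox θ h = ∅ := by
              refine eq_empty_of_forall_notMem fun z hz => hw ?_
              exact mem_arcShell_of_mem_shellPairs hdh hz.2 hz.1
            simp [this]
  · exact ((measurable_deriv f).enorm.pow_const p).indicator (measurableSet_arcShell θ h d)

/-- This is where the logarithm pays: since `h ≤ 1`, `log (2 / d) ≥ (j + 1) log 2` for `d = h / 2 ^
j`, which cancels `(j + 1) ^ p` and leaves a bound uniform in `j`. -/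
lemma shell_coefficient_le {p s h x : ℝ} (hp : 0 < p) (h0 : 0 < h) (h1 : h ≤ 1) (j : ℕ)
    (hx : h / 2 ^ j / 4 < x) (hx' : x < 2 * (h / 2 ^ j)) :
    ((j : ℝ) + 1) ^ p * (16 / Real.pi * (h / 2 ^ j) ^ (p - 2)) *
        ((h / 2 ^ j) ^ s * (Real.log (2 / (h / 2 ^ j)) ^ p)⁻¹) ≤
      16 / Real.pi * (Real.log 2 ^ p)⁻¹ * 4 ^ |p - 2 + s| * x ^ (p - 2 + s) := by
  set d := h / 2 ^ j with hd
  have hd0 : 0 < d := by positivity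
  have hl2 : 0 < Real.log 2 := Real.log_pos (by norm_num)
  have hlog : ((j : ℝ) + 1) * Real.log 2 ≤ Real.log (2 / d) := by
    have : Real.log ((2:ℝ) ^ (j + 1)) ≤ Real.log (2 / d) := by
      refine Real.log_le_log (by positivity) ?_
      rw [hd, le_div_iff₀ (by positivity), pow_succ]
      field_simp
      linarith
    rw [Real.log_pow] at this
    exact_mod_cast this
  have hlogp : 0 < Real.log (2 / d) := lt_of_lt_of_le (by positivity) hlog
  have e1 : ((j : ℝ) + 1) ^ p * (Real.log (2 / d) ^ p)⁻¹ ≤ (Real.log 2 ^ p)⁻¹ := by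
    rw [← div_eq_mul_inv, div_le_iff₀ (by positivity), inv_mul_eq_div,
      le_div_iff₀ (by positivity), ← Real.mul_rpow (by positivity) hl2.le]
    exact Real.rpow_le_rpow (by positivity) hlog hp.le
  have e2 : d ^ (p - 2) * d ^ s ≤ 4 ^ |p - 2 + s| * x ^ (p - 2 + s) := by
    rw [← Real.rpow_add hd0]
    exact Real.rpow_le_mul_rpow_of_comparable _ hd0 (by linarith) (by norm_num) (by linarith)
      (by linarith)
  have hpi := Real.pi_pos
  have hx0 : 0 < x := by linarith
  calc _ = 16 / Real.pi * (((j : ℝ) + 1) ^ p * (Real.log (2 / d) ^ p)⁻¹) *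
        (d ^ (p - 2) * d ^ s) := by ring
    _ ≤ 16 / Real.pi * (Real.log 2 ^ p)⁻¹ * (4 ^ |p - 2 + s| * x ^ (p - 2 + s)) := by gcongr
    _ = _ := by ring

/-- Shells have bounded overlap: if `j₀` is the first shell containing `w`, then any other index `j`
satisfies `2 ^ j < 8 * 2 ^ j₀`, so at most three occur. -/
lemma tsum_indicator_arcShell_le (θ : ℝ) {h : ℝ} (h0 : 0 < h) (g : ℂ → ℝ≥0∞) (w : ℂ) :
    ∑' j : ℕ, (arcShell θ h (h / 2 ^ j)).indicator g w ≤
      3 * {w : ℂ | ‖w‖ < 1 ∧ ‖w - Complex.exp (θ * Complex.I)‖ < 9 * h}.indicator g w := by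
  classical
  by_cases hex : ∃ j : ℕ, w ∈ arcShell θ h (h / 2 ^ j)
  · set j₀ := Nat.find hex
    have hj₀ : w ∈ arcShell θ h (h / 2 ^ j₀) := Nat.find_spec hex
    have hV : w ∈ {w : ℂ | ‖w‖ < 1 ∧ ‖w - Complex.exp (θ * Complex.I)‖ < 9 * h} := by
      refine ⟨?_, hj₀.2.2⟩
      have : 0 < h / 2 ^ j₀ := by positivity
      linarith [hj₀.1]
    rw [indicator_of_mem hV, tsum_eq_sum (s := Finset.Ico j₀ (j₀ + 3))]
    · refine (Finset.sum_le_card_nsmul _ _ (g w) fun j _ => indicator_le_self _ _ _).trans ?_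
      simp
    · intro j hj
      refine indicator_of_notMem (fun hmem => hj ?_) _
      refine Finset.mem_Ico.mpr ⟨Nat.find_min' hex hmem, ?_⟩
      have h1 : h / 2 ^ j₀ / 4 < 2 * (h / 2 ^ j) := hj₀.1.trans hmem.2.1
      have h2 : (2 : ℝ) ^ j < 2 ^ (j₀ + 3) := by
        rw [div_div, ← mul_div_assoc, div_lt_div_iff₀ (by positivity) (by positivity)] at h1
        rw [pow_add]
        nlinarith
      exact (pow_lt_pow_iff_right₀ (by norm_num)).mp h2
  · push Not at hex
    have : ∀ j : ℕ, (arcShell θ h (h / 2 ^ j)).indicator g w = 0 := fun j =>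
      indicator_of_notMem (hex j) _
    simp [this]

/-- Test the energy at `a = (1 - h / 2) e^{iθ}`. In the region `|1 - conj a * w| ≤ 9 h + h / 2`,
which is below `20 (1 - |a|)`, so `le_fWeight` applies. -/
lemma EnergyLE.lintegral_near_arc_le {p s : ℝ} (hs : 0 < s) {f : ℂ → ℂ} {E : ℝ≥0∞}
    (hE : EnergyLE p s f E) (θ : ℝ) {h : ℝ} (h0 : 0 < h) (h1 : h ≤ 1) :
    ∫⁻ w in {w : ℂ | ‖w‖ < 1 ∧ ‖w - Complex.exp (θ * Complex.I)‖ < 9 * h},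
        ‖deriv f w‖ₑ ^ p * ENNReal.ofReal ((1 - ‖w‖) ^ (p - 2 + s)) ≤
      ENNReal.ofReal (Real.pi / ((2 ^ |p - 2|)⁻¹ * ((20 : ℝ) ^ 2) ^ (-s) * 2⁻¹ ^ (-s)) * h ^ s) *
        E := by
  set u := Complex.exp (θ * Complex.I) with hu
  have hun : ‖u‖ = 1 := Complex.norm_exp_ofReal_mul_I θ
  have huu : (starRingEnd ℂ) u * u = 1 := by
    rw [Complex.conj_mul', hun]; simp
  set a : ℂ := ((1 - h / 2 : ℝ) : ℂ) * u with ha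
  have han : ‖a‖ = 1 - h / 2 := norm_ofReal_mul_of_norm_eq_one hun (by linarith)
  have hS : MeasurableSet {w : ℂ | ‖w‖ < 1 ∧ ‖w - u‖ < 9 * h} :=
    (measurableSet_unitDisk.congr (by ext; simp [mem_unitDisk]) :
      MeasurableSet {w : ℂ | ‖w‖ < 1}).inter
      (measurableSet_norm_sub_lt _ _)
  refine (hE.setLIntegral_le (a := a)
    (c := (2 ^ |p - 2|)⁻¹ * ((20 : ℝ) ^ 2) ^ (-s) * (h / 2) ^ (-s))
    (by rw [han]; linarith) hS (fun w hw => mem_unitDisk.mpr hw.1) (fun w hw => ?_)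
    (by positivity)).trans (le_of_eq ?_)
  · have h2 : ‖1 - (starRingEnd ℂ) a * w‖ ≤ 20 * (1 - ‖a‖) := by
      have e : 1 - (starRingEnd ℂ) a * w = (starRingEnd ℂ) u * ((u - w) + ((h / 2 : ℝ) : ℂ) * w) := by
        rw [ha, map_mul, Complex.conj_ofReal, mul_add, mul_sub, huu]
        push_cast; ring
      rw [e, norm_mul, RCLike.norm_conj, hun, one_mul, han]
      refine (norm_add_le _ _).trans ?_
      rw [norm_sub_rev, norm_mul, Complex.norm_real, Real.norm_of_nonneg (by linarith)]
      have := hw.2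
      nlinarith [hw.1, norm_nonneg w]
    have h3 := le_fWeight (p := p) hs (by rw [han]; linarith) hw.1 (by norm_num) h2
    rwa [han, sub_sub_cancel] at h3
  · congr 2
    rw [div_eq_mul_inv h 2, Real.mul_rpow h0.le (by positivity), Real.rpow_neg h0.le]
    field_simp

/-! ### The quantitative Carleson embedding. -/

lemma exists_enorm_rpow_le_tsum {p : ℝ} (hp : 0 < p) : ∃ C : ℝ≥0∞, C ≠ ∞ ∧
    ∀ (f : ℂ → ℂ), DifferentiableOn ℂ f unitDisk → ∀ (θ h : ℝ), 0 < h → h ≤ 1 →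
      ∀ z ∈ carlesonBox θ h, ‖f z‖ₑ ^ p ≤
        C * (‖f (((1 - h : ℝ) : ℂ) * (z / (‖z‖ : ℂ)))‖ₑ ^ p +
          ∑' j : ℕ, ENNReal.ofReal (((j : ℝ) + 1) ^ p) *
            (ENNReal.ofReal (16 / Real.pi * (h / 2 ^ j) ^ (p - 2)) *
              ∫⁻ w, (shellPairs (h / 2 ^ j)).indicator (fun q => ‖deriv f q.2‖ₑ ^ p) (z, w))) := by
  obtain ⟨C, hC, hCb⟩ := ENNReal.exists_sum_rpow_le_weighted hp
  refine ⟨ENNReal.LpAddConst (ENNReal.ofReal p)⁻¹ * max 1 C,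
    ENNReal.mul_ne_top (ENNReal.LpAddConst_lt_top _).ne (max_lt ENNReal.one_lt_top hC.lt_top).ne,
    fun f hf θ h h0 h1 z hz => ?_⟩
  have hz0 : z ≠ 0 := norm_pos_iff.mp (by linarith [hz.1])
  have hn : (‖z‖ : ℂ) ≠ 0 := by simpa using hz0
  have hζ : ‖z / (‖z‖ : ℂ)‖ = 1 := by simp [hz0]
  classical
  set A : ℕ → ℝ≥0∞ := fun j => ENNReal.ofReal (16 / Real.pi * (h / 2 ^ j) ^ (p - 2)) *
    ∫⁻ w, (shellPairs (h / 2 ^ j)).indicator (fun q => ‖deriv f q.2‖ₑ ^ p) (z, w) with hA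
  -- Shells starting beyond `z` get the trivial bound `∞`: the mean value estimate is unavailable
  -- there, and the telescoping sum never reaches them.
  set B : ℕ → ℝ≥0∞ := fun j => if 1 - h / 2 ^ j < ‖z‖ then A j ^ p⁻¹ else ∞ with hB
  have hstep : ∀ j : ℕ, ∀ r ∈ Icc (1 - h / 2 ^ j) (1 - h / 2 ^ (j + 1)),
      ENNReal.ofReal (h / 2 ^ j) * ‖deriv f ((r : ℂ) * (z / (‖z‖ : ℂ)))‖ₑ ≤ B j := by
    intro j r hr
    rw [hB]
    simp only
    split_ifs with hj
    · have hle : h / 2 ^ j ≤ 1 := (div_le_self h0.le (one_le_pow₀ (by norm_num))).trans h1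
      rw [ENNReal.le_rpow_inv_iff hp]
      refine deriv_rpow_le_lintegral_shell hp hf (by positivity) hz0 hj hz.2.1 ⟨hr.1, ?_⟩
        (by linarith [hr.1])
      have e : h / 2 ^ (j + 1) = h / 2 ^ j / 2 := by rw [pow_succ]; field_simp
      rw [← e]
      exact hr.2
    · exact le_top
  obtain ⟨n, hn1, hn2⟩ := exists_enorm_le_add_sum hf hζ h0 h1 hstep hz.1 hz.2.1
  rw [mul_div_cancel₀ _ hn] at hn2
  have hsum : (∑ j ∈ Finset.range n, B j) ^ p ≤
      C * ∑' j : ℕ, ENNReal.ofReal (((j : ℝ) + 1) ^ p) * A j := by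
    refine (hCb B n).trans ?_
    gcongr
    refine le_trans (le_of_eq ?_) (ENNReal.sum_le_tsum (Finset.range n))
    refine Finset.sum_congr rfl fun j hj => ?_
    rw [hB]
    simp only [if_pos (hn1 j (Finset.mem_range.mp hj))]
    rw [ENNReal.rpow_inv_rpow hp.ne']
  refine (ENNReal.rpow_le_rpow hn2 hp.le).trans
    ((ENNReal.rpow_add_le_mul_rpow_add_rpow' _ _ hp.le).trans ?_)
  rw [mul_assoc]
  gcongr
  rw [mul_add]
  refine add_le_add (le_mul_of_one_le_left' (le_max_left _ _)) (hsum.trans ?_)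
  gcongr
  exact le_max_right _ _

/-- Bloch growth gives `log (1 / h)`; enlarging it to `log (2 / h) ≥ log 2` lets the same factor
absorb `f 0`, even at `h = 1`. -/
lemma exists_enorm_at_top_le (p s : ℝ) (hp : 0 < p) (hs : 0 < s) : ∃ C : ℝ≥0∞, C ≠ ∞ ∧
    ∀ (f : ℂ → ℂ) (E : ℝ≥0), DifferentiableOn ℂ f unitDisk → EnergyLE p s f E →
      ∀ (h : ℝ), 0 < h → h ≤ 1 → ∀ ζ : ℂ, ‖ζ‖ = 1 →
        ‖f (((1 - h : ℝ) : ℂ) * ζ)‖ₑ ^ p ≤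
          C * ENNReal.ofReal (Real.log (2 / h) ^ p) * (‖f 0‖ₑ ^ p + E) := by
  obtain ⟨CB, hCB, hbloch⟩ := exists_bloch_bound p s hp hs
  have hl2 : 0 < Real.log 2 := Real.log_pos (by norm_num)
  set K : ℝ := max (Real.log 2)⁻¹ CB with hK
  have hKpos : 0 < K := lt_max_of_lt_right hCB
  refine ⟨ENNReal.ofReal (K ^ p) * ENNReal.LpAddConst (ENNReal.ofReal p)⁻¹,
    ENNReal.mul_ne_top ENNReal.ofReal_ne_top (ENNReal.LpAddConst_lt_top _).ne,
    fun f E hf hE h h0 h1 ζ hζ => ?_⟩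
  have hn : ‖((1 - h : ℝ) : ℂ) * ζ‖ = 1 - h :=
    norm_ofReal_mul_of_norm_eq_one hζ (by linarith)
  have hb := norm_le_of_bloch hf (hbloch f E hf hE) (z := ((1 - h : ℝ) : ℂ) * ζ)
    (by rw [hn]; linarith)
  rw [hn, sub_sub_cancel] at hb
  have hlog2 := log_two_le_log_two_div h0 h1
  have hlogpos := log_two_div_pos h0 h1
  have hlog1 : Real.log (1 / h) ≤ Real.log (2 / h) := Real.log_le_log (by positivity) (by gcongr; norm_num)
  have hE0 : 0 ≤ (E : ℝ) ^ (1 / p) := by positivity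
  have hreal : ‖f (((1 - h : ℝ) : ℂ) * ζ)‖ ≤ K * Real.log (2 / h) * (‖f 0‖ + (E : ℝ) ^ (1 / p)) := by
    have e1 : 1 ≤ K * Real.log (2 / h) := by
      calc 1 = (Real.log 2)⁻¹ * Real.log 2 := (inv_mul_cancel₀ hl2.ne').symm
        _ ≤ K * Real.log (2 / h) := by
          gcongr
          exact le_max_left _ _
    have e2 : CB * (E : ℝ) ^ (1 / p) * Real.log (1 / h) ≤
        K * (E : ℝ) ^ (1 / p) * Real.log (2 / h) := by
      refine mul_le_mul ?_ hlog1 (Real.log_nonneg (by rw [le_div_iff₀ h0]; linarith)) (by positivity)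
      gcongr
      exact le_max_right _ _
    nlinarith [norm_nonneg (f 0), mul_le_mul_of_nonneg_right e1 (norm_nonneg (f 0))]
  have henn : ‖f (((1 - h : ℝ) : ℂ) * ζ)‖ₑ ≤
      ENNReal.ofReal (K * Real.log (2 / h)) * (‖f 0‖ₑ + (E : ℝ≥0∞) ^ (1 / p)) := by
    rw [← ofReal_norm, ← ofReal_norm, ← ENNReal.ofReal_coe_nnreal,
      ENNReal.ofReal_rpow_of_nonneg E.coe_nonneg (by positivity),
      ← ENNReal.ofReal_add (norm_nonneg _) hE0, ← ENNReal.ofReal_mul (by positivity)]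
    exact ENNReal.ofReal_le_ofReal hreal
  calc ‖f (((1 - h : ℝ) : ℂ) * ζ)‖ₑ ^ p
      ≤ (ENNReal.ofReal (K * Real.log (2 / h)) * (‖f 0‖ₑ + (E : ℝ≥0∞) ^ (1 / p))) ^ p :=
        ENNReal.rpow_le_rpow henn hp.le
    _ ≤ ENNReal.ofReal ((K * Real.log (2 / h)) ^ p) *
        (ENNReal.LpAddConst (ENNReal.ofReal p)⁻¹ *
          (‖f 0‖ₑ ^ p + ((E : ℝ≥0∞) ^ (1 / p)) ^ p)) := by
        rw [ENNReal.mul_rpow_of_nonneg _ _ hp.le,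
          ENNReal.ofReal_rpow_of_nonneg (by positivity) hp.le]
        gcongr
        exact ENNReal.rpow_add_le_mul_rpow_add_rpow' _ _ hp.le
    _ = _ := by
        rw [one_div, ENNReal.rpow_inv_rpow hp.ne', Real.mul_rpow hKpos.le hlogpos.le,
          ENNReal.ofReal_mul (by positivity)]
        ring

lemma measurable_lintegral_shellPairs (p : ℝ) (f : ℂ → ℂ) (d : ℝ) :
    Measurable fun z => ∫⁻ w, (shellPairs d).indicator (fun q => ‖deriv f q.2‖ₑ ^ p) (z, w) :=
  Measurable.lintegral_prod_right' ((((measurable_deriv f).comp measurable_snd).enorm.pow_const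
    p).indicator (measurableSet_shellPairs d))

lemma exists_tsum_shell_le (p s : ℝ) (hp : 0 < p) (hs : 0 < s) : ∃ C : ℝ≥0∞, C ≠ ∞ ∧
    ∀ (f : ℂ → ℂ) (E : ℝ≥0∞), EnergyLE p s f E →
      ∀ (ν : Measure ℂ) [SFinite ν] (N : ℝ≥0∞), LogCarlesonLE p s ν N →
      ∀ (θ h : ℝ), 0 < h → h ≤ 1 →
        ∑' j : ℕ, ENNReal.ofReal (((j : ℝ) + 1) ^ p) *
          (ENNReal.ofReal (16 / Real.pi * (h / 2 ^ j) ^ (p - 2)) *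
            ∫⁻ z in carlesonBox θ h, (∫⁻ w, (shellPairs (h / 2 ^ j)).indicator
              (fun q => ‖deriv f q.2‖ₑ ^ p) (z, w)) ∂ν) ≤
        C * ENNReal.ofReal (h ^ s) * N * E := by
  have hpi := Real.pi_pos
  have hl2 : 0 < Real.log 2 := Real.log_pos (by norm_num)
  set K : ℝ := 16 / Real.pi * (Real.log 2 ^ p)⁻¹ * 4 ^ |p - 2 + s| with hK
  have hKpos : 0 < K := by positivity
  set K' : ℝ := Real.pi / ((2 ^ |p - 2|)⁻¹ * ((20 : ℝ) ^ 2) ^ (-s) * 2⁻¹ ^ (-s)) with hK'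
  have hK'pos : 0 < K' := by positivity
  -- The 6 is two boxes per slice times threefold overlap of the shells.
  refine ⟨ENNReal.ofReal K * 6 * ENNReal.ofReal K',
    ENNReal.mul_ne_top (ENNReal.mul_ne_top ENNReal.ofReal_ne_top (by norm_num))
      ENNReal.ofReal_ne_top, fun f E hE ν _ N hN θ h h0 h1 => ?_⟩
  set G : ℂ → ℝ≥0∞ := fun w => ‖deriv f w‖ₑ ^ p * ENNReal.ofReal ((1 - ‖w‖) ^ (p - 2 + s)) with hG
  have hGm : Measurable G := by
    have := measurable_deriv f
    exact (this.enorm.pow_const p).mul (by fun_prop)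
  have hterm : ∀ j : ℕ, ENNReal.ofReal (((j : ℝ) + 1) ^ p) *
      (ENNReal.ofReal (16 / Real.pi * (h / 2 ^ j) ^ (p - 2)) *
        ∫⁻ z in carlesonBox θ h, (∫⁻ w, (shellPairs (h / 2 ^ j)).indicator
          (fun q => ‖deriv f q.2‖ₑ ^ p) (z, w)) ∂ν) ≤
      ENNReal.ofReal K * 2 * N * ∫⁻ w, (arcShell θ h (h / 2 ^ j)).indicator G w := fun j => by
    have hd0 : 0 < h / 2 ^ j := by positivity
    have hdh : h / 2 ^ j ≤ h := div_le_self h0.le (one_le_pow₀ (by norm_num))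
    have hlogd := log_two_div_pos hd0 (hdh.trans h1)
    refine (mul_le_mul_right (mul_le_mul_right (hN.lintegral_shell_le f θ hd0 hdh h1) _) _).trans ?_
    rw [lintegral_indicator (measurableSet_arcShell _ _ _)]
    set d := h / 2 ^ j with hd
    calc _ = (2 * N) * (ENNReal.ofReal (((j : ℝ) + 1) ^ p * (16 / Real.pi * d ^ (p - 2)) *
          (d ^ s * (Real.log (2 / d) ^ p)⁻¹)) * ∫⁻ w in arcShell θ h d, ‖deriv f w‖ₑ ^ p) := by
          rw [ENNReal.ofReal_mul (p := ((j : ℝ) + 1) ^ p * (16 / Real.pi * d ^ (p - 2)))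
            (by positivity), ENNReal.ofReal_mul (p := ((j : ℝ) + 1) ^ p) (by positivity)]
          ring
      _ ≤ (2 * N) * (ENNReal.ofReal K * ∫⁻ w in arcShell θ h d, G w) := by
          refine mul_le_mul_right ?_ _
          rw [← lintegral_const_mul' _ _ ENNReal.ofReal_ne_top,
            ← lintegral_const_mul' _ _ ENNReal.ofReal_ne_top]
          refine setLIntegral_mono' (measurableSet_arcShell _ _ _) fun w hw => ?_
          simp only [hG]
          rw [mul_left_comm (ENNReal.ofReal K), ← ENNReal.ofReal_mul hKpos.le, mul_comm]
          refine mul_le_mul_right (ENNReal.ofReal_le_ofReal ?_) _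
          exact shell_coefficient_le hp h0 h1 j hw.1 hw.2.1
      _ = _ := by ring
  calc _ ≤ ∑' j : ℕ, ENNReal.ofReal K * 2 * N *
        ∫⁻ w, (arcShell θ h (h / 2 ^ j)).indicator G w := ENNReal.tsum_le_tsum hterm
    _ = ENNReal.ofReal K * 2 * N * ∫⁻ w, ∑' j : ℕ, (arcShell θ h (h / 2 ^ j)).indicator G w := by
        rw [ENNReal.tsum_mul_left, lintegral_tsum fun j =>
          (hGm.indicator (measurableSet_arcShell _ _ _)).aemeasurable]
    _ ≤ ENNReal.ofReal K * 2 * N * ∫⁻ w, 3 *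
        {w : ℂ | ‖w‖ < 1 ∧ ‖w - Complex.exp (θ * Complex.I)‖ < 9 * h}.indicator G w := by
        gcongr with w
        exact tsum_indicator_arcShell_le θ h0 G w
    _ = ENNReal.ofReal K * 2 * N * (3 * ∫⁻ w in
        {w : ℂ | ‖w‖ < 1 ∧ ‖w - Complex.exp (θ * Complex.I)‖ < 9 * h}, G w) := by
        rw [lintegral_const_mul' _ _ (by norm_num), lintegral_indicator]
        exact (measurableSet_unitDisk.congr (by ext; simp [mem_unitDisk]) :
          MeasurableSet {w : ℂ | ‖w‖ < 1}).inter (measurableSet_norm_sub_lt _ _)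
    _ ≤ ENNReal.ofReal K * 2 * N * (3 * (ENNReal.ofReal (K' * h ^ s) * E)) := by
        gcongr
        exact hE.lintegral_near_arc_le hs θ h0 h1
    _ = _ := by
        rw [ENNReal.ofReal_mul hK'pos.le]
        ring

/-- Logarithmic Carleson measures embed `F(p,p-2,s)` into the tent space, quantitatively. -/
theorem exists_carleson_embedding (p s : ℝ) (hp : 0 < p) (hs : 0 < s) : ∃ C : ℝ≥0∞, C ≠ ∞ ∧
    ∀ (f : ℂ → ℂ) (E : ℝ≥0), DifferentiableOn ℂ f unitDisk → EnergyLE p s f E →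
      ∀ (ν : Measure ℂ) [SFinite ν] (N : ℝ≥0∞), LogCarlesonLE p s ν N →
      ∀ θ : ℝ, ∀ h ∈ Ioc (0 : ℝ) 1,
        ENNReal.ofReal (h ^ (-s)) * ∫⁻ z in carlesonBox θ h, ‖f z‖ₑ ^ p ∂ν ≤
          C * N * (‖f 0‖ₑ ^ p + E) := by
  obtain ⟨C₁, hC₁, H₁⟩ := exists_enorm_at_top_le p s hp hs
  obtain ⟨C₂, hC₂, H₂⟩ := exists_tsum_shell_le p s hp hs
  obtain ⟨C₃, hC₃, H₃⟩ := exists_enorm_rpow_le_tsum hp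
  refine ⟨C₃ * (C₁ + C₂), ENNReal.mul_ne_top hC₃ (ENNReal.add_ne_top.mpr ⟨hC₁, hC₂⟩),
    fun f E hf hE ν _ N hN θ h ⟨h0, h1⟩ => ?_⟩
  have hlogpos := log_two_div_pos h0 h1
  set A : ℕ → ℂ → ℝ≥0∞ := fun j z => ENNReal.ofReal (((j : ℝ) + 1) ^ p) *
    (ENNReal.ofReal (16 / Real.pi * (h / 2 ^ j) ^ (p - 2)) *
      ∫⁻ w, (shellPairs (h / 2 ^ j)).indicator (fun q => ‖deriv f q.2‖ₑ ^ p) (z, w)) with hA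
  have hAm : ∀ j, Measurable (A j) := fun j =>
    ((measurable_lintegral_shellPairs p f _).const_mul _).const_mul _
  set Q : ℝ≥0∞ := C₁ * ENNReal.ofReal (Real.log (2 / h) ^ p) * (‖f 0‖ₑ ^ p + E) with hQ
  have hpt : ∀ z ∈ carlesonBox θ h, ‖f z‖ₑ ^ p ≤ C₃ * (Q + ∑' j, A j z) := fun z hz => by
    refine (H₃ f hf θ h h0 h1 z hz).trans ?_
    gcongr
    exact H₁ f E hf hE h h0 h1 _ (norm_eq_one_of_mem_circleArc hz.2.2)
  have hsecond : ∫⁻ z in carlesonBox θ h, ∑' j, A j z ∂ν ≤ C₂ * ENNReal.ofReal (h ^ s) * N * E := by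
    rw [lintegral_tsum fun j => (hAm j).aemeasurable]
    refine le_trans (le_of_eq ?_) (H₂ f E hE ν N hN θ h h0 h1)
    refine tsum_congr fun j => ?_
    rw [hA, lintegral_const_mul' _ _ ENNReal.ofReal_ne_top,
      lintegral_const_mul' _ _ ENNReal.ofReal_ne_top]
  calc ENNReal.ofReal (h ^ (-s)) * ∫⁻ z in carlesonBox θ h, ‖f z‖ₑ ^ p ∂ν
      ≤ ENNReal.ofReal (h ^ (-s)) * ∫⁻ z in carlesonBox θ h, C₃ * (Q + ∑' j, A j z) ∂ν := by
        exact mul_le_mul_right (setLIntegral_mono' (measurableSet_carlesonBox θ h) hpt) _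
    _ = ENNReal.ofReal (h ^ (-s)) * (C₃ * (Q * ν (carlesonBox θ h) +
          ∫⁻ z in carlesonBox θ h, ∑' j, A j z ∂ν)) := by
        rw [lintegral_const_mul' _ _ hC₃, lintegral_add_left measurable_const, setLIntegral_const]
    _ ≤ ENNReal.ofReal (h ^ (-s)) * (C₃ * (Q * ν (carlesonBox θ h) +
          C₂ * ENNReal.ofReal (h ^ s) * N * E)) := by gcongr
    -- The starting value on the radius contributes exactly the quantity in the Carleson condition
    -- for this box; in the shell sum the powers of `h` cancel.
    _ = C₃ * (C₁ * (ENNReal.ofReal (h ^ (-s) * Real.log (2 / h) ^ p) * ν (carlesonBox θ h)) *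
          (‖f 0‖ₑ ^ p + E) + C₂ * (ENNReal.ofReal (h ^ (-s)) * ENNReal.ofReal (h ^ s)) * N * E) := by
        rw [hQ, ENNReal.ofReal_mul (by positivity)]
        ring
    _ ≤ C₃ * (C₁ * N * (‖f 0‖ₑ ^ p + E) + C₂ * 1 * N * (‖f 0‖ₑ ^ p + E)) := by
        gcongr
        · exact hN θ h ⟨h0, h1⟩
        · rw [← ENNReal.ofReal_mul (by positivity), ← Real.rpow_add h0, neg_add_cancel,
            Real.rpow_zero, ENNReal.ofReal_one]
        · exact le_add_self
    _ = _ := by ring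

/-! ### Vanishing measures: finiteness, and smallness near the circle. -/

lemma IsVanishingLogCarleson.exists_forall_le {p s : ℝ} {μ : Measure ℂ}
    (H : IsVanishingLogCarleson p s μ) {ε : ℝ≥0∞} (hε : 0 < ε) : ∃ h₀ : ℝ, 0 < h₀ ∧ h₀ ≤ 1 ∧
      ∀ θ h : ℝ, 0 < h → h ≤ h₀ →
        ENNReal.ofReal (h ^ (-s) * Real.log (2 / h) ^ p) * μ (carlesonBox θ h) ≤ ε := by
  have h1 := ENNReal.tendsto_nhds_zero.mp H ε hε
  obtain ⟨u, hu, hsub⟩ := mem_nhdsGT_iff_exists_Ioo_subset.mp h1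
  have hu0 : 0 < u := hu
  refine ⟨min (u / 2) 1, by positivity, min_le_right _ _, fun θ h h0 hh => ?_⟩
  have h2 : h ∈ Ioo 0 u := ⟨h0, by linarith [hh.trans (min_le_left _ _)]⟩
  exact (le_iSup (fun θ : ℝ => ENNReal.ofReal (h ^ (-s) * Real.log (2 / h) ^ p) *
    μ (carlesonBox θ h)) θ).trans (hsub h2)

lemma exists_mem_carlesonBox {h : ℝ} (h0 : 0 < h) {z : ℂ} (hz : z ≠ 0) (hz1 : ‖z‖ < 1)
    (hzh : 1 - h < ‖z‖) : ∃ i ∈ Icc ⌊-Real.pi / (2 * Real.pi * h)⌋ ⌊Real.pi / (2 * Real.pi * h)⌋,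
      z ∈ carlesonBox (2 * Real.pi * h * i) h := by
  have hpi := Real.pi_pos
  have hc : 0 < 2 * Real.pi * h := by positivity
  refine ⟨⌊z.arg / (2 * Real.pi * h)⌋, ⟨Int.floor_mono ?_, Int.floor_mono ?_⟩,
    hzh, hz1, z.arg, ⟨?_, ?_⟩, ?_⟩
  · gcongr; exact (Complex.neg_pi_lt_arg z).le
  · gcongr; exact Complex.arg_le_pi z
  · have := Int.floor_le (z.arg / (2 * Real.pi * h))
    rw [le_div_iff₀ hc] at this
    linarith
  · have := (Int.lt_floor_add_one (z.arg / (2 * Real.pi * h))).le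
    rw [div_le_iff₀ hc] at this
    linarith
  · have hn : (‖z‖ : ℂ) ≠ 0 := by simpa using hz
    simp only
    rw [eq_div_iff hn, mul_comm, Complex.norm_mul_exp_arg_mul_I]

/-- Finitely many boxes of one small side, each of finite mass, cover an annulus; the rest of the
disk is compact. -/
lemma IsVanishingLogCarleson.isFiniteMeasure {p s : ℝ} {μ : Measure ℂ}
    (H : IsVanishingLogCarleson p s μ) (hμD : μ unitDiskᶜ = 0)
    (hμfin : ∀ K : Set ℂ, IsCompact K → K ⊆ unitDisk → μ K < ∞) : IsFiniteMeasure μ := by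
  obtain ⟨h, h0, h1, hle⟩ := H.exists_forall_le one_pos
  have hbox : ∀ θ, μ (carlesonBox θ h) < ∞ := fun θ => by
    have := hle θ h h0 le_rfl
    have hlog := log_two_div_pos h0 h1
    have hc : ENNReal.ofReal (h ^ (-s) * Real.log (2 / h) ^ p) ≠ 0 := by
      rw [Ne, ENNReal.ofReal_eq_zero, not_le]; positivity
    exact ENNReal.lt_top_of_mul_ne_top_right (this.trans_lt ENNReal.one_lt_top).ne hc
  have hcover : (univ : Set ℂ) ⊆ (unitDiskᶜ ∪ Metric.closedBall 0 (1 - h)) ∪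
      ⋃ i ∈ Icc ⌊-Real.pi / (2 * Real.pi * h)⌋ ⌊Real.pi / (2 * Real.pi * h)⌋,
        carlesonBox (2 * Real.pi * h * i) h := by
    intro z _
    by_cases hz1 : ‖z‖ < 1
    · by_cases hzh : 1 - h < ‖z‖
      · obtain ⟨i, hi, hzi⟩ := exists_mem_carlesonBox h0
          (norm_pos_iff.mp (by linarith)) hz1 hzh
        exact Or.inr (mem_biUnion hi hzi)
      · exact Or.inl (Or.inr (by simpa using hzh))
    · exact Or.inl (Or.inl fun hz => hz1 (mem_unitDisk.mp hz))
  refine ⟨(measure_mono hcover).trans_lt (measure_union_lt_top (measure_union_lt_top ?_ ?_) ?_)⟩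
  · simp [hμD]
  · refine hμfin _ (isCompact_closedBall _ _) fun z hz => ?_
    rw [mem_unitDisk]
    have : ‖z‖ ≤ 1 - h := by simpa using hz
    linarith
  · exact measure_biUnion_lt_top (Set.finite_Icc _ _) fun i _ => hbox _

lemma measurableSet_lt_norm (r : ℝ) : MeasurableSet {z : ℂ | r < ‖z‖} :=
  measurableSet_lt (by fun_prop) (by fun_prop)

lemma exists_measure_annulus_le {μ : Measure ℂ} [IsFiniteMeasure μ] (hμD : μ unitDiskᶜ = 0)
    {ε : ℝ≥0∞} (hε : 0 < ε) : ∃ δ : ℝ, 0 < δ ∧ δ < 1 ∧ μ {z : ℂ | 1 - δ < ‖z‖} ≤ ε := by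
  have hanti : Antitone fun n : ℕ => {z : ℂ | 1 - 1 / ((n : ℝ) + 2) < ‖z‖} := by
    intro m n hmn z hz
    have h1 : 1 / ((n : ℝ) + 2) ≤ 1 / ((m : ℝ) + 2) := by gcongr
    have h2 : 1 - 1 / ((n : ℝ) + 2) < ‖z‖ := hz
    show 1 - 1 / ((m : ℝ) + 2) < ‖z‖
    linarith
  have hlim := tendsto_measure_iInter_atTop (μ := μ)
    (fun n : ℕ => (measurableSet_lt_norm (1 - 1 / ((n : ℝ) + 2))).nullMeasurableSet) hanti
    ⟨0, measure_ne_top _ _⟩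
  have hzero : μ (⋂ n : ℕ, {z : ℂ | 1 - 1 / ((n : ℝ) + 2) < ‖z‖}) = 0 := by
    refine measure_mono_null (fun z hz => ?_) hμD
    intro hzD
    rw [mem_unitDisk] at hzD
    obtain ⟨n, hn⟩ := exists_nat_one_div_lt (by linarith : 0 < 1 - ‖z‖)
    have h1 : 1 - 1 / ((n : ℝ) + 2) < ‖z‖ := mem_iInter.mp hz n
    have h2 : 1 / ((n : ℝ) + 2) ≤ 1 / ((n : ℝ) + 1) := by gcongr; norm_num
    linarith
  rw [hzero] at hlim
  obtain ⟨n, hn⟩ := (ENNReal.tendsto_nhds_zero.mp hlim ε hε).exists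
  refine ⟨1 / ((n : ℝ) + 2), by positivity, ?_, hn⟩
  rw [div_lt_one (by positivity)]
  linarith [(Nat.cast_nonneg n : (0 : ℝ) ≤ n)]

/-- The restriction of a vanishing logarithmic Carleson measure to a thin annulus has small
logarithmic Carleson constant. -/
lemma IsVanishingLogCarleson.exists_logCarlesonLE_restrict {p s : ℝ} (hp : 0 < p) (hs : 0 < s)
    {μ : Measure ℂ} [IsFiniteMeasure μ] (H : IsVanishingLogCarleson p s μ)
    (hμD : μ unitDiskᶜ = 0) {ε : ℝ≥0∞} (hε : 0 < ε) :
    ∃ δ : ℝ, 0 < δ ∧ δ < 1 ∧ LogCarlesonLE p s (μ.restrict {z : ℂ | 1 - δ < ‖z‖}) ε := by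
  obtain ⟨h₀, h00, h01, hle⟩ := H.exists_forall_le hε
  set M : ℝ := h₀ ^ (-s) * Real.log (2 / h₀) ^ p with hM
  have hlog0 := log_two_div_pos h00 h01
  have hMpos : 0 < M := by positivity
  obtain ⟨δ, hδ0, hδ1, hδ⟩ := exists_measure_annulus_le hμD
    (ε := ε / ENNReal.ofReal M) (ENNReal.div_pos hε.ne' ENNReal.ofReal_ne_top)
  refine ⟨δ, hδ0, hδ1, fun θ h ⟨h0, h1⟩ => ?_⟩
  rcases le_total h h₀ with hh | hh
  · refine le_trans ?_ (hle θ h h0 hh)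
    gcongr
    exact Measure.restrict_le_self
  -- For large boxes the coefficient is decreasing in `h`, hence at most `M`, and `δ` was chosen so
  -- that the whole annulus has mass at most `ε / M`.
  · have hlog := log_two_div_pos h0 h1
    calc ENNReal.ofReal (h ^ (-s) * Real.log (2 / h) ^ p) *
          (μ.restrict {z : ℂ | 1 - δ < ‖z‖}) (carlesonBox θ h)
        ≤ ENNReal.ofReal M * (ε / ENNReal.ofReal M) := by
          refine mul_le_mul' (ENNReal.ofReal_le_ofReal ?_) ?_
          · refine mul_le_mul (Real.rpow_le_rpow_of_nonpos h00 hh (by linarith))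
              (Real.rpow_le_rpow hlog.le (Real.log_le_log (by positivity) ?_) hp.le)
              (by positivity) (by positivity)
            gcongr
          · refine (measure_mono (subset_univ _)).trans ?_
            rw [Measure.restrict_apply_univ]
            exact hδ
      _ ≤ ε := ENNReal.mul_div_le

/-- Split each box at radius `1 - δ`. The outer part is handled by the embedding; only boxes with `h
> δ` meet the inner disk, so there `h ^ (-s) ≤ δ ^ (-s)` and a sup bound on `f` suffices. -/
lemma exists_tent_bound (p s : ℝ) (hp : 0 < p) (hs : 0 < s) : ∃ C : ℝ≥0∞, C ≠ ∞ ∧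
    ∀ (f : ℂ → ℂ) (E : ℝ≥0), DifferentiableOn ℂ f unitDisk → EnergyLE p s f E →
      ∀ (μ : Measure ℂ) [IsFiniteMeasure μ] (N B : ℝ≥0∞) (δ : ℝ), 0 < δ →
      LogCarlesonLE p s (μ.restrict {z : ℂ | 1 - δ < ‖z‖}) N →
      (∀ z : ℂ, ‖z‖ ≤ 1 - δ → ‖f z‖ₑ ^ p ≤ B) →
      (⨆ (θ : ℝ) (h ∈ Ioc (0 : ℝ) 1),
        ENNReal.ofReal (h ^ (-s)) * ∫⁻ z in carlesonBox θ h, ‖f z‖ₑ ^ p ∂μ) ≤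
          C * N * (‖f 0‖ₑ ^ p + E) + ENNReal.ofReal (δ ^ (-s)) * (B * μ univ) := by
  obtain ⟨C, hC, H⟩ := exists_carleson_embedding p s hp hs
  refine ⟨C, hC, fun f E hf hE μ _ N B δ hδ hN hB => iSup_le fun θ => iSup₂_le fun h hh => ?_⟩
  have hA := measurableSet_lt_norm (1 - δ)
  rw [← lintegral_inter_add_sdiff _ (carlesonBox θ h) hA, mul_add]
  refine add_le_add ?_ ?_
  · refine le_trans (le_of_eq ?_) (H f E hf hE _ N hN θ h hh)
    rw [Measure.restrict_restrict (measurableSet_carlesonBox θ h)]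
  · rcases le_or_gt h δ with hhδ | hhδ
    · have : carlesonBox θ h \ {z : ℂ | 1 - δ < ‖z‖} = ∅ := by
        rw [sdiff_eq_empty]
        intro z hz
        show 1 - δ < ‖z‖
        linarith [hz.1]
      simp [this]
    · refine mul_le_mul' (ENNReal.ofReal_le_ofReal
        (Real.rpow_le_rpow_of_nonpos hδ hhδ.le (by linarith))) ?_
      calc ∫⁻ z in carlesonBox θ h \ {z : ℂ | 1 - δ < ‖z‖}, ‖f z‖ₑ ^ p ∂μ
          ≤ ∫⁻ z in carlesonBox θ h \ {z : ℂ | 1 - δ < ‖z‖}, B ∂μ :=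
            setLIntegral_mono' ((measurableSet_carlesonBox θ h).diff hA) fun z hz =>
              hB z (not_lt.mp hz.2)
        _ ≤ B * μ univ := by
            rw [setLIntegral_const]
            gcongr
            exact subset_univ _

lemma aemeasurable_of_differentiableOn_unitDisk {μ : Measure ℂ} (hμD : μ unitDiskᶜ = 0)
    {f : ℂ → ℂ} (hf : DifferentiableOn ℂ f unitDisk) : AEMeasurable f μ := by
  have h1 : AEMeasurable f (μ.restrict unitDisk) :=
    hf.continuousOn.aemeasurable measurableSet_unitDisk
  rwa [Measure.restrict_eq_self_of_ae_mem] at h1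
  exact measure_eq_zero_iff_ae_notMem.mp hμD |>.mono fun z hz => by simpa using hz

lemma fSpace_subset_tentSpace {p s : ℝ} (hp : 0 < p) (hs : 0 < s) {μ : Measure ℂ}
    [IsFiniteMeasure μ] (hμD : μ unitDiskᶜ = 0) (H : IsVanishingLogCarleson p s μ) :
    fSpace p (p - 2) s ⊆ tentSpace p s μ := by
  rintro f ⟨hf, hfin⟩
  refine ⟨aemeasurable_of_differentiableOn_unitDisk hμD hf, ?_⟩
  obtain ⟨C, hC, hb⟩ := exists_tent_bound p s hp hs
  obtain ⟨δ, hδ0, hδ1, hN⟩ := H.exists_logCarlesonLE_restrict hp hs hμD one_pos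
  have hE := energyLE_of_fSeminorm_le (s := s) hp (le_refl (fSeminorm p (p - 2) s f))
  obtain ⟨E, hEeq⟩ := WithTop.ne_top_iff_exists.mp (ENNReal.rpow_ne_top_of_nonneg hp.le hfin.ne)
  rw [← hEeq] at hE
  have hsub : Metric.closedBall (0 : ℂ) (1 - δ) ⊆ unitDisk :=
    Metric.closedBall_subset_ball (by linarith)
  obtain ⟨B, hB⟩ := (isCompact_closedBall (0 : ℂ) (1 - δ)).exists_bound_of_continuousOn
    (hf.continuousOn.mono hsub)
  have key := hb f E hf hE μ 1 (ENNReal.ofReal B ^ p) δ hδ0 hN fun z hz => by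
    rw [← ofReal_norm]
    exact ENNReal.rpow_le_rpow (ENNReal.ofReal_le_ofReal (hB z (by simpa using hz))) hp.le
  refine ENNReal.rpow_lt_top_of_nonneg (by positivity) (ne_top_of_le_ne_top ?_ key)
  refine ENNReal.add_ne_top.mpr ⟨ENNReal.mul_ne_top (ENNReal.mul_ne_top hC ENNReal.one_ne_top)
    (ENNReal.add_ne_top.mpr ⟨?_, ENNReal.coe_ne_top⟩), ENNReal.mul_ne_top ENNReal.ofReal_ne_top
    (ENNReal.mul_ne_top ?_ (measure_ne_top _ _))⟩
  · exact ENNReal.rpow_ne_top_of_nonneg hp.le enorm_ne_top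
  · exact ENNReal.rpow_ne_top_of_nonneg hp.le ENNReal.ofReal_ne_top

/-! ### Normal families and compactness of the embedding. -/

/-- Montel's theorem on the unit disk for sequences of functions with uniform Bloch bounds. -/
lemma exists_subseq_tendstoLocallyUniformlyOn {F : ℕ → ℂ → ℂ} {B₀ B : ℝ}
    (hF : ∀ n, DifferentiableOn ℂ (F n) unitDisk) (hF0 : ∀ n, ‖F n 0‖ ≤ B₀)
    (hB : ∀ n, ∀ a : ℂ, ‖a‖ < 1 → ‖deriv (F n) a‖ ≤ B / (1 - ‖a‖)) :
    ∃ (g : ℂ → ℂ) (k : ℕ → ℕ), StrictMono k ∧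
      TendstoLocallyUniformlyOn (fun n => F (k n)) g atTop unitDisk := by
  have hB0 : 0 ≤ B := by
    have := (norm_nonneg _).trans (hB 0 0 (by simp))
    simpa using this
  have : LocallyCompactSpace unitDisk := isOpen_unitDisk.locallyCompactSpace
  have hlt : ∀ x : unitDisk, ‖(x : ℂ)‖ < 1 := fun x => mem_unitDisk.mp x.2
  -- The mean value inequality on the convex disk of radius `max |x| |y|` gives this common modulus
  -- of continuity.
  set ω : unitDisk → unitDisk → ℝ := fun x y =>
    B / (1 - max ‖(x : ℂ)‖ ‖(y : ℂ)‖) * ‖(y : ℂ) - x‖ with hω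
  set b : unitDisk → ℝ := fun x => B₀ + B * Real.log (1 / (1 - ‖(x : ℂ)‖)) with hb
  have hωlim : ∀ x, Tendsto (ω x) (𝓝 x) (𝓝 0) := fun x => by
    have hc : ContinuousAt (ω x) x := by
      have h1 : 1 - max ‖(x : ℂ)‖ ‖(x : ℂ)‖ ≠ 0 := by
        rw [max_self]; linarith [hlt x]
      have h2 : ContinuousAt (fun y : unitDisk => 1 - max ‖(x : ℂ)‖ ‖(y : ℂ)‖) x := by fun_prop
      exact (continuousAt_const.div h2 h1).mul (by fun_prop)
    have h3 : ω x x = 0 := by simp [hω]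
    have h4 := hc.tendsto
    rwa [h3] at h4
  -- These conditions are closed under pointwise limits, so `T` is compact by Tychonoff; the modulus
  -- forces every member to be continuous, so `T` is exactly the image of `S`, as Arzelà–Ascoli
  -- requires.
  set T : Set (unitDisk → ℂ) :=
    {G | (∀ x, ‖G x‖ ≤ b x) ∧ ∀ x y, dist (G x) (G y) ≤ ω x y} with hT
  have hTc : IsCompact T := by
    refine IsCompact.of_isClosed_subset
      (isCompact_univ_pi fun x => isCompact_closedBall (0 : ℂ) (b x)) ?_ ?_
    · rw [hT, ofPred_and]
      simp only [ofPred_forall]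
      refine (isClosed_iInter fun x => isClosed_le (by fun_prop) continuous_const).inter
        (isClosed_iInter fun x => isClosed_iInter fun y => isClosed_le (by fun_prop)
          continuous_const)
    · intro G hG x _
      simpa using hG.1 x
  set S : Set C(unitDisk, ℂ) := {G | (G : unitDisk → ℂ) ∈ T} with hS
  have hScompact : IsCompact S := by
    refine ArzelaAscoli.isCompact_of_equicontinuous S ?_ ?_
    · have e : ContinuousMap.toFun '' S = T := by
        ext G
        constructor
        · rintro ⟨G', hG', rfl⟩
          exact hG'
        · intro hG
          refine ⟨⟨G, continuous_iff_continuousAt.mpr fun x => ?_⟩, hG, rfl⟩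
          rw [ContinuousAt, tendsto_iff_dist_tendsto_zero]
          refine squeeze_zero (fun _ => dist_nonneg) (fun y => ?_) (hωlim x)
          rw [dist_comm]
          exact hG.2 x y
      rw [e]
      exact hTc
    · intro x
      exact Metric.equicontinuousAt_of_continuity_modulus (ω x) (hωlim x) _
        (Eventually.of_forall fun y G => G.2.2 x y)
  set Φ : ℕ → C(unitDisk, ℂ) := fun n => ⟨fun x => F n x, (hF n).continuousOn.domRestrict⟩ with hΦ
  have hΦS : ∀ n, Φ n ∈ S := fun n => by
    refine ⟨fun x => ?_, fun x y => ?_⟩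
    · refine (norm_le_of_bloch (hF n) (hB n) (hlt x)).trans ?_
      simp only [hb]
      linarith [hF0 n]
    · set R := max ‖(x : ℂ)‖ ‖(y : ℂ)‖ with hR
      have hR1 : R < 1 := max_lt (hlt x) (hlt y)
      rw [dist_comm, dist_eq_norm]
      refine (convex_closedBall (0 : ℂ) R).norm_image_sub_le_of_norm_deriv_le (𝕜 := ℂ) (f := F n)
        (C := B / (1 - R)) (fun w hw => ?_) (fun w hw => ?_) ?_ ?_
      · have hw' : ‖w‖ ≤ R := by simpa using hw
        exact (hF n).differentiableAt (isOpen_unitDisk.mem_nhds (mem_unitDisk.mpr (by linarith)))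
      · have hw' : ‖w‖ ≤ R := by simpa using hw
        refine (hB n w (by linarith)).trans ?_
        gcongr
      · simp [hR]
      · simp [hR]
  obtain ⟨G, -, k, hk, hlim⟩ := hScompact.tendsto_subseq hΦS
  classical
  refine ⟨fun z => if hz : z ∈ unitDisk then G ⟨z, hz⟩ else 0, k, hk, ?_⟩
  rw [tendstoLocallyUniformlyOn_iff_tendstoLocallyUniformly_comp_coe]
  have h1 := ContinuousMap.tendsto_iff_tendstoLocallyUniformly.mp hlim
  have e : (fun z => if hz : z ∈ unitDisk then G ⟨z, hz⟩ else 0) ∘ ((↑) : unitDisk → ℂ) = G := by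
    ext x
    simp
  rw [e]
  exact h1

lemma measurable_fWeight (p s : ℝ) (a : ℂ) : Measurable (fWeight p s a) := by
  unfold fWeight moebius
  fun_prop

/-- Derivatives also converge pointwise, so Fatou's lemma gives lower semicontinuity of each energy
integral. -/
lemma EnergyLE.of_tendstoLocallyUniformlyOn {p s : ℝ} {F : ℕ → ℂ → ℂ} {g : ℂ → ℂ}
    {E : ℝ≥0∞} (hF : ∀ n, DifferentiableOn ℂ (F n) unitDisk) (hE : ∀ n, EnergyLE p s (F n) E)
    (hlim : TendstoLocallyUniformlyOn F g atTop unitDisk) : EnergyLE p s g E := by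
  intro a ha
  have hd := hlim.deriv (Eventually.of_forall hF) isOpen_unitDisk
  calc ∫⁻ z in unitDisk, ‖deriv g z‖ₑ ^ p * ENNReal.ofReal (fWeight p s a z) ∂areaMeasure
      = ∫⁻ z in unitDisk, liminf (fun n => ‖deriv (F n) z‖ₑ ^ p *
          ENNReal.ofReal (fWeight p s a z)) atTop ∂areaMeasure := by
        refine setLIntegral_congr_fun measurableSet_unitDisk fun z hz => ?_
        refine (Tendsto.liminf_eq ?_).symm
        refine ENNReal.Tendsto.mul_const ?_ (Or.inr ENNReal.ofReal_ne_top)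
        exact ((ENNReal.continuous_rpow_const (y := p)).tendsto _).comp
          ((continuous_enorm.tendsto _).comp (hd.tendsto_at hz))
    _ ≤ liminf (fun n => ∫⁻ z in unitDisk, ‖deriv (F n) z‖ₑ ^ p *
          ENNReal.ofReal (fWeight p s a z) ∂areaMeasure) atTop := by
        refine lintegral_liminf_le fun n => ?_
        exact ((measurable_deriv (F n)).enorm.pow_const p).mul (measurable_fWeight p s a).ennreal_ofReal
    _ ≤ E := by
        refine (liminf_le_liminf (Eventually.of_forall fun n => hE n a ha)).trans ?_
        simp

lemma EnergyLE.sub {p s : ℝ} (hp : 0 < p) {f g : ℂ → ℂ} {E E' : ℝ≥0∞}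
    (hf : DifferentiableOn ℂ f unitDisk) (hg : DifferentiableOn ℂ g unitDisk)
    (hfE : EnergyLE p s f E) (hgE : EnergyLE p s g E') :
    EnergyLE p s (fun z => f z - g z) (ENNReal.LpAddConst (ENNReal.ofReal p)⁻¹ * (E + E')) := by
  intro a ha
  have hfm : Measurable fun z => ‖deriv f z‖ₑ ^ p * ENNReal.ofReal (fWeight p s a z) :=
    ((measurable_deriv f).enorm.pow_const p).mul (measurable_fWeight p s a).ennreal_ofReal
  calc ∫⁻ z in unitDisk, ‖deriv (fun z => f z - g z) z‖ₑ ^ p *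
        ENNReal.ofReal (fWeight p s a z) ∂areaMeasure
      ≤ ∫⁻ z in unitDisk, ENNReal.LpAddConst (ENNReal.ofReal p)⁻¹ *
        (‖deriv f z‖ₑ ^ p * ENNReal.ofReal (fWeight p s a z) +
          ‖deriv g z‖ₑ ^ p * ENNReal.ofReal (fWeight p s a z)) ∂areaMeasure := by
        refine setLIntegral_mono' measurableSet_unitDisk fun z hz => ?_
        rw [← add_mul, ← mul_assoc]
        gcongr
        have hnhds := isOpen_unitDisk.mem_nhds hz
        rw [deriv_fun_sub (hf.differentiableAt hnhds) (hg.differentiableAt hnhds)]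
        exact (ENNReal.rpow_le_rpow enorm_sub_le hp.le).trans
          (ENNReal.rpow_add_le_mul_rpow_add_rpow' _ _ hp.le)
    _ = _ := by
        rw [lintegral_const_mul' _ _ (ENNReal.LpAddConst_lt_top _).ne, lintegral_add_left hfm]
    _ ≤ _ := by
        gcongr
        exacts [hfE a ha, hgE a ha]

/-- A vanishing logarithmic Carleson measure induces a compact embedding. -/
theorem IsVanishingLogCarleson.isCompactIdentity {p s : ℝ} (hp : 0 < p) (hs : 0 < s)
    {μ : Measure ℂ} (hμD : μ unitDiskᶜ = 0)
    (hμfin : ∀ K : Set ℂ, IsCompact K → K ⊆ unitDisk → μ K < ∞)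
    (H : IsVanishingLogCarleson p s μ) : IsCompactIdentity p (p - 2) s μ := by
  have := H.isFiniteMeasure hμD hμfin
  refine ⟨fSpace_subset_tentSpace hp hs hμD H, fun f hf ⟨M, hM⟩ => ?_⟩
  have hfd : ∀ n, DifferentiableOn ℂ (f n) unitDisk := fun n => (hf n).1
  have hfE : ∀ n, EnergyLE p s (f n) ((M ^ p : ℝ≥0) : ℝ≥0∞) := fun n => by
    rw [ENNReal.coe_rpow_of_nonneg _ hp.le]
    exact energyLE_of_fSeminorm_le hp (le_add_self.trans (hM n))
  obtain ⟨CB, hCB, hbloch⟩ := exists_bloch_bound p s hp hs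
  obtain ⟨g, k, hk, hlim⟩ := exists_subseq_tendstoLocallyUniformlyOn (B₀ := M) hfd
    (fun n => by
      have : ‖f n 0‖ₑ ≤ M := le_self_add.trans (hM n)
      rw [← ofReal_norm, ← ENNReal.ofReal_coe_nnreal,
        ENNReal.ofReal_le_ofReal_iff M.coe_nonneg] at this
      exact this)
    (fun n => hbloch (f n) _ (hfd n) (hfE n))
  have hgd : DifferentiableOn ℂ g unitDisk :=
    hlim.differentiableOn (Eventually.of_forall fun n => hfd (k n)) isOpen_unitDisk
  have hgE : EnergyLE p s g ((M ^ p : ℝ≥0) : ℝ≥0∞) :=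
    EnergyLE.of_tendstoLocallyUniformlyOn (fun n => hfd (k n)) (fun n => hfE (k n)) hlim
  have hgF : g ∈ fSpace p (p - 2) s :=
    ⟨hgd, (hgE.fSeminorm_le hp).trans_lt (ENNReal.rpow_lt_top_of_nonneg (by positivity)
      ENNReal.coe_ne_top)⟩
  refine ⟨g, fSpace_subset_tentSpace hp hs hμD H hgF, k, hk, ?_⟩
  obtain ⟨C, hC, hb⟩ := exists_tent_bound p s hp hs
  set E₁ : ℝ≥0∞ := ENNReal.LpAddConst (ENNReal.ofReal p)⁻¹ *
    (((M ^ p : ℝ≥0) : ℝ≥0∞) + ((M ^ p : ℝ≥0) : ℝ≥0∞)) with hE₁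
  have hE₁top : E₁ ≠ ∞ := ENNReal.mul_ne_top (ENNReal.LpAddConst_lt_top _).ne
    (ENNReal.add_ne_top.mpr ⟨ENNReal.coe_ne_top, ENNReal.coe_ne_top⟩)
  obtain ⟨E, hE⟩ := WithTop.ne_top_iff_exists.mp hE₁top
  have hdE : ∀ n, EnergyLE p s (fun z => f (k n) z - g z) E := fun n => by
    rw [show (E : ℝ≥0∞) = E₁ from hE]
    exact EnergyLE.sub hp (hfd _) hgd (hfE _) hgE
  have hsup : Tendsto (fun n => ⨆ (θ : ℝ) (h ∈ Ioc (0 : ℝ) 1), ENNReal.ofReal (h ^ (-s)) *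
      ∫⁻ z in carlesonBox θ h, ‖f (k n) z - g z‖ₑ ^ p ∂μ) atTop (𝓝 0) := by
    refine ENNReal.tendsto_nhds_zero.mpr fun ε hε => ?_
    rcases eq_or_ne ε ∞ with rfl | hεtop
    · simp
    have hε2 : 0 < ε / 2 := ENNReal.div_pos hε.ne' (by norm_num)
    set K₁ : ℝ≥0∞ := C * (1 + E) with hK₁
    have hK₁top : K₁ ≠ ∞ := ENNReal.mul_ne_top hC
      (ENNReal.add_ne_top.mpr ⟨ENNReal.one_ne_top, ENNReal.coe_ne_top⟩)
    -- The order of choices matters: `N` determines the annulus and hence `δ`, and the tolerance `B`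
    -- on the inner disk then depends on `δ` through `K₂`.
    set N : ℝ≥0∞ := ε / 2 / (K₁ + 1) with hN
    have hNpos : 0 < N :=
      ENNReal.div_pos hε2.ne' (ENNReal.add_ne_top.mpr ⟨hK₁top, ENNReal.one_ne_top⟩)
    obtain ⟨δ, hδ0, hδ1, hcar⟩ := H.exists_logCarlesonLE_restrict hp hs hμD hNpos
    set K₂ : ℝ≥0∞ := ENNReal.ofReal (δ ^ (-s)) * μ univ with hK₂
    have hK₂top : K₂ ≠ ∞ := ENNReal.mul_ne_top ENNReal.ofReal_ne_top (measure_ne_top _ _)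
    -- The 1 bounds the value of the difference at the origin, which enters the embedding estimate.
    set B : ℝ≥0∞ := min 1 (ε / 2 / (K₂ + 1)) with hB
    have hBpos : 0 < B := lt_min one_pos
      (ENNReal.div_pos hε2.ne' (ENNReal.add_ne_top.mpr ⟨hK₂top, ENNReal.one_ne_top⟩))
    have hBroot : 0 < B ^ p⁻¹ :=
      ENNReal.rpow_pos hBpos ((min_le_left _ _).trans_lt ENNReal.one_lt_top).ne
    have hsub : Metric.closedBall (0 : ℂ) (1 - δ) ⊆ unitDisk :=
      Metric.closedBall_subset_ball (by linarith)
    have hunif := (tendstoLocallyUniformlyOn_iff_forall_isCompact isOpen_unitDisk).mp hlim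
      _ hsub (isCompact_closedBall 0 (1 - δ))
    filter_upwards [EMetric.tendstoUniformlyOn_iff.mp hunif _ hBroot] with n hn
    have hpt : ∀ z : ℂ, ‖z‖ ≤ 1 - δ → ‖f (k n) z - g z‖ₑ ^ p ≤ B := fun z hz => by
      have := (hn z (by simpa using hz)).le
      rwa [edist_comm, edist_eq_enorm_sub, ENNReal.le_rpow_inv_iff hp] at this
    refine (hb _ E ((hfd _).sub hgd) (hdE n) μ N B δ hδ0 hcar hpt).trans ?_
    calc _ ≤ C * N * (1 + E) + ENNReal.ofReal (δ ^ (-s)) * (ε / 2 / (K₂ + 1) * μ univ) := by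
          gcongr
          · exact (hpt 0 (by simpa using hδ1.le)).trans (min_le_left _ _)
          · exact min_le_right _ _
      _ = K₁ * (ε / 2 / (K₁ + 1)) + K₂ * (ε / 2 / (K₂ + 1)) := by
          rw [hK₁, hK₂, hN]; ring
      _ ≤ (K₁ + 1) * (ε / 2 / (K₁ + 1)) + (K₂ + 1) * (ε / 2 / (K₂ + 1)) := by
          gcongr <;> exact le_self_add
      _ ≤ ε / 2 + ε / 2 := add_le_add ENNReal.mul_div_le ENNReal.mul_div_le
      _ = ε := ENNReal.add_halves ε
  have hpos : 0 < 1 / p := by positivity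
  have h2 := ((ENNReal.continuous_rpow_const (y := 1 / p)).tendsto 0).comp hsup
  rw [ENNReal.zero_rpow_of_pos hpos] at h2
  exact h2

/-! ### Forelli–Rudin estimates and energies of kernels. -/

lemma lintegral_Ico_one_sub_rpow {t ρ : ℝ} (ht : -1 < t) (hρ : 0 < ρ) :
    ∫⁻ r in Ico (1 - ρ) 1, ENNReal.ofReal ((1 - r) ^ t) = ENNReal.ofReal (ρ ^ (t + 1) / (t + 1)) := by
  have hi : IntervalIntegrable (fun r : ℝ => (1 - r) ^ t) volume (1 - ρ) 1 := by
    have := (intervalIntegral.intervalIntegrable_rpow' (a := ρ) (b := 0) ht).comp_sub_left 1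
    simpa using this
  rw [← ofReal_integral_eq_lintegral_ofReal, integral_Ico_eq_integral_Ioo,
    ← integral_Ioc_eq_integral_Ioo, ← intervalIntegral.integral_of_le (by linarith),
    intervalIntegral.integral_comp_sub_left (fun r : ℝ => r ^ t), sub_self, sub_sub_cancel,
    integral_rpow (Or.inl ht), Real.zero_rpow (by linarith), sub_zero]
  · exact ((intervalIntegrable_iff_integrableOn_Icc_of_le (by linarith)).mp hi).mono_set
      Ico_subset_Icc_self
  · filter_upwards [ae_restrict_mem measurableSet_Ico] with r hr
    exact Real.rpow_nonneg (by linarith [hr.2]) _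

lemma arg_abs_le_of_norm_sub_one_le {z : ℂ} {ρ : ℝ} (hz : z ≠ 0) (hz1 : ‖z‖ < 1)
    (h : ‖z - 1‖ ≤ ρ) : |z.arg| ≤ Real.pi * ρ := by
  have hn : (‖z‖ : ℂ) ≠ 0 := by simpa using hz
  have h1 : ‖z / (‖z‖ : ℂ)‖ = 1 := by simp [hz]
  have h2 := Complex.angle_le_mul_norm_sub h1 (norm_one (α := ℂ))
  rw [Complex.angle_one_right (norm_pos_iff.mp (by rw [h1]; norm_num))] at h2
  have h3 : (z / (‖z‖ : ℂ)).arg = z.arg := by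
    rw [div_eq_inv_mul, ← Complex.ofReal_inv,
      Complex.arg_real_mul _ (inv_pos.mpr (norm_pos_iff.mpr hz))]
  rw [h3] at h2
  have h4 : ‖z / (‖z‖ : ℂ) - z‖ = 1 - ‖z‖ := by
    have : z / (‖z‖ : ℂ) - z = ((1 - ‖z‖ : ℝ) : ℂ) * (z / (‖z‖ : ℂ)) := by
      push_cast
      field_simp
    rw [this]
    exact norm_ofReal_mul_of_norm_eq_one h1 (by linarith)
  have h5 := norm_sub_le_norm_sub_add_norm_sub (z / (‖z‖ : ℂ)) z 1
  have h6 := norm_sub_norm_le (1 : ℂ) z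
  rw [norm_one, norm_sub_rev] at h6
  have := Real.pi_pos
  nlinarith

/-- In polar coordinates the region lies in `[1 - ρ, 1) × [-π ρ, π ρ]`; the radial integral gives `ρ
^ (t + 1)` and the angle one more `ρ`. -/
lemma setLIntegral_one_sub_norm_rpow_le {t ρ : ℝ} (ht : -1 < t) (hρ : 0 < ρ) :
    ∫⁻ z in unitDisk ∩ {z : ℂ | ‖z - 1‖ ≤ ρ}, ENNReal.ofReal ((1 - ‖z‖) ^ t) ≤
      ENNReal.ofReal (2 * Real.pi / (t + 1) * ρ ^ (t + 2)) := by
  have hpi := Real.pi_pos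
  have hS : MeasurableSet (unitDisk ∩ {z : ℂ | ‖z - 1‖ ≤ ρ}) :=
    measurableSet_unitDisk.inter (measurableSet_le (by fun_prop) (by fun_prop))
  have hbox : MeasurableSet (Ico (1 - ρ) 1 ×ˢ Icc (-(Real.pi * ρ)) (Real.pi * ρ)) :=
    measurableSet_Ico.prod measurableSet_Icc
  rw [← lintegral_indicator hS, ← Complex.lintegral_comp_polarCoord_symm]
  calc _ ≤ ∫⁻ q in polarCoord.target, (Ico (1 - ρ) 1 ×ˢ Icc (-(Real.pi * ρ)) (Real.pi * ρ)).indicator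
          (fun q : ℝ × ℝ => ENNReal.ofReal ((1 - q.1) ^ t)) q := by
        refine setLIntegral_mono' polarCoord.open_target.measurableSet fun q hq => ?_
        obtain ⟨hr, hθ⟩ := hq
        have hr0 : 0 < q.1 := hr
        have hn : ‖Complex.polarCoord.symm q‖ = q.1 := by
          rw [Complex.norm_polarCoord_symm, abs_of_pos hr0]
        by_cases hz : Complex.polarCoord.symm q ∈ unitDisk ∩ {z : ℂ | ‖z - 1‖ ≤ ρ}
        · have hz1 : q.1 < 1 := by rw [← hn]; exact mem_unitDisk.mp hz.1
          have harg : (Complex.polarCoord.symm q).arg = q.2 := by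
            rw [Complex.polarCoord_symm_apply, Complex.ofReal_cos, Complex.ofReal_sin,
              Complex.arg_mul_cos_add_sin_mul_I hr0 ⟨hθ.1, hθ.2.le⟩]
          have h1 := arg_abs_le_of_norm_sub_one_le
            (norm_pos_iff.mp (by rw [hn]; exact hr0)) (by rw [hn]; exact hz1) hz.2
          rw [harg] at h1
          have h2 := norm_sub_norm_le (1 : ℂ) (Complex.polarCoord.symm q)
          rw [norm_one, norm_sub_rev, hn] at h2
          have h3 : ‖Complex.polarCoord.symm q - 1‖ ≤ ρ := hz.2
          rw [indicator_of_mem hz, hn, indicator_of_mem (show q ∈ Ico (1 - ρ) 1 ×ˢ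
            Icc (-(Real.pi * ρ)) (Real.pi * ρ) from ⟨⟨by linarith, hz1⟩, abs_le.mp h1⟩), smul_eq_mul]
          exact mul_le_of_le_one_left' (ENNReal.ofReal_le_one.mpr hz1.le)
        · rw [indicator_of_notMem hz, smul_zero]
          exact zero_le
    _ ≤ ∫⁻ q in Ico (1 - ρ) 1 ×ˢ Icc (-(Real.pi * ρ)) (Real.pi * ρ),
          ENNReal.ofReal ((1 - q.1) ^ t) := by
        rw [← lintegral_indicator hbox]
        exact setLIntegral_le_lintegral _ _
    _ = ENNReal.ofReal (ρ ^ (t + 1) / (t + 1)) * ENNReal.ofReal (2 * Real.pi * ρ) := by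
        rw [Measure.volume_eq_prod, ← Measure.prod_restrict, lintegral_prod _ (by fun_prop)]
        simp only [lintegral_const, Measure.restrict_apply_univ, Real.volume_Icc]
        rw [lintegral_mul_const _ (by fun_prop), lintegral_Ico_one_sub_rpow ht hρ]
        congr 2
        ring
    _ = _ := by
        rw [← ENNReal.ofReal_mul (by have : 0 < t + 1 := by linarith
                                     positivity)]
        congr 1
        rw [show t + 2 = (t + 1) + 1 by ring, Real.rpow_add_one hρ.ne' (t + 1)]
        ring

lemma setLIntegral_unitDisk_rotate {α : ℂ} (hα : ‖α‖ = 1) (G : ℂ → ℝ≥0∞) :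
    ∫⁻ z in unitDisk, G (α * z) = ∫⁻ z in unitDisk, G z := by
  set R := rotation ⟨α, mem_sphere_zero_iff_norm.mpr hα⟩
  have h1 := R.measurePreserving.setLIntegral_comp_preimage_emb
    R.toHomeomorph.measurableEmbedding G unitDisk
  rw [← h1]
  have h2 : R ⁻¹' unitDisk = unitDisk := by
    ext z
    simp [mem_unitDisk]
  rw [h2]
  rfl

/-- A Forelli–Rudin type estimate with a singularity on the circle. -/
lemma exists_singular_integral_le {p s : ℝ} (hp : 0 < p) (hs : 0 < s) (hsp : 1 < s + p) :
    ∃ C : ℝ≥0, ∀ A : ℝ, 0 < A → ∀ α : ℂ, ‖α‖ = 1 →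
      ∫⁻ z in unitDisk, ENNReal.ofReal ((1 - ‖z‖) ^ (p - 2 + s)) *
        ENNReal.ofReal (‖z - α‖ ^ (-p) * (A + ‖z - α‖) ^ (-(2 * s))) ≤
      C * ENNReal.ofReal (A ^ (-s)) := by
  have hpi := Real.pi_pos
  set t := p - 2 + s with ht
  have ht1 : -1 < t := by linarith
  have ht2 : 0 < t + 1 := by linarith
  set c : ℝ := 2 * Real.pi / (t + 1) with hc
  have hc0 : 0 < c := by positivity
  set q : ℝ := (2⁻¹ : ℝ) ^ s with hq
  have hq1 : q < 1 := Real.rpow_lt_one (by norm_num) (by norm_num) hs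
  have hq0 : 0 < q := by positivity
  have hsum : (∑' j : ℕ, ENNReal.ofReal (q ^ j)) ≠ ∞ :=
    (summable_geometric_of_lt_one hq0.le hq1).tsum_ofReal_ne_top
  set S : ℝ≥0∞ := ∑' j : ℕ, ENNReal.ofReal (q ^ j) with hS
  set D : ℝ≥0∞ := ENNReal.ofReal (c * 2 ^ (p + s)) * S + ENNReal.ofReal (c * 2 ^ p) * S with hD
  have hDtop : D ≠ ∞ := ENNReal.add_ne_top.mpr
    ⟨ENNReal.mul_ne_top ENNReal.ofReal_ne_top hsum, ENNReal.mul_ne_top ENNReal.ofReal_ne_top hsum⟩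
  refine ⟨D.toNNReal, fun A hA α hα => ?_⟩
  rw [ENNReal.coe_toNNReal hDtop]
  have hqpow : ∀ j : ℕ, q ^ j = ((2 : ℝ) ^ j) ^ (-s) := fun j => by
    rw [hq, ← Real.rpow_natCast, ← Real.rpow_natCast, ← Real.rpow_mul (by norm_num),
      ← Real.rpow_mul (by norm_num), Real.inv_rpow (by norm_num), ← Real.rpow_neg (by norm_num)]
    congr 1
    ring
  rw [← setLIntegral_unitDisk_rotate hα]
  have hrot : ∀ z : ℂ, ‖α * z‖ = ‖z‖ ∧ ‖α * z - α‖ = ‖z - 1‖ := fun z => by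
    refine ⟨by rw [norm_mul, hα, one_mul], ?_⟩
    rw [show α * z - α = α * (z - 1) by ring, norm_mul, hα, one_mul]
  simp_rw [(hrot _).1, (hrot _).2]
  set W : ℂ → ℝ≥0∞ := fun z => ENNReal.ofReal ((1 - ‖z‖) ^ t) with hW
  have hWm : Measurable W := by fun_prop
  set V : ℝ → Set ℂ := fun ρ => {z : ℂ | ‖z - 1‖ ≤ ρ} with hV
  have hVm : ∀ ρ, MeasurableSet (V ρ) := fun ρ => measurableSet_le (by fun_prop) (by fun_prop)
  -- Here `o` and `i` bound the kernel on dyadic annuli outside and inside distance `A` from the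
  -- pole. Since `t + 2 = p + s`, annulus `j` contributes a multiple of `A ^ (-s) * 2 ^ (-j s)` in
  -- both regimes, so both sums are geometric.
  set o : ℕ → ℝ := fun j => (A * 2 ^ j) ^ (-p) * (A * 2 ^ j) ^ (-(2 * s)) with ho
  set i : ℕ → ℝ := fun j => (A / 2 ^ (j + 1)) ^ (-p) * A ^ (-(2 * s)) with hi
  have hpt : ∀ z ∈ unitDisk, W z * ENNReal.ofReal (‖z - 1‖ ^ (-p) * (A + ‖z - 1‖) ^ (-(2 * s))) ≤
      ∑' j : ℕ, (V (A * 2 ^ (j + 1))).indicator W z * ENNReal.ofReal (o j) +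
        ∑' j : ℕ, (V (A / 2 ^ j)).indicator W z * ENNReal.ofReal (i j) := by
    intro z hz
    have hzn : 0 < ‖z - 1‖ := norm_pos_iff.mpr (sub_ne_zero.mpr fun h => by
      rw [h, mem_unitDisk, norm_one] at hz; exact lt_irrefl _ hz)
    rcases le_or_gt A ‖z - 1‖ with h | h
    · obtain ⟨j, hj1, hj2⟩ := exists_nat_pow_near ((one_le_div hA).mpr h) one_lt_two
      rw [le_div_iff₀ hA, mul_comm] at hj1
      rw [div_lt_iff₀ hA, mul_comm] at hj2
      refine le_trans ?_ (le_trans (ENNReal.le_tsum j) le_self_add)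
      rw [indicator_of_mem (show z ∈ V (A * 2 ^ (j + 1)) from hj2.le)]
      gcongr
      refine mul_le_mul (Real.rpow_le_rpow_of_nonpos (by positivity) hj1 (by linarith))
        (Real.rpow_le_rpow_of_nonpos (by positivity) (by linarith) (by linarith))
        (by positivity) (by positivity)
    · obtain ⟨j, hj1, hj2⟩ := exists_nat_pow_near_of_lt_one (div_pos hzn hA)
        ((div_le_one hA).mpr h.le) (by norm_num : (0 : ℝ) < 2⁻¹) (by norm_num)
      rw [lt_div_iff₀ hA, inv_pow, inv_mul_eq_div] at hj1
      rw [div_le_iff₀ hA, inv_pow, inv_mul_eq_div] at hj2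
      refine le_trans ?_ (le_trans (ENNReal.le_tsum j) le_add_self)
      rw [indicator_of_mem (show z ∈ V (A / 2 ^ j) from hj2)]
      gcongr
      refine mul_le_mul (Real.rpow_le_rpow_of_nonpos (by positivity) hj1.le (by linarith))
        (Real.rpow_le_rpow_of_nonpos (by positivity) (by linarith) (by linarith))
        (by positivity) (by positivity)
  have hVint : ∀ ρ, 0 < ρ → ∫⁻ z in unitDisk, (V ρ).indicator W z ≤
      ENNReal.ofReal (c * ρ ^ (t + 2)) := fun ρ hρ => by
    rw [lintegral_indicator (hVm ρ), Measure.restrict_restrict (hVm ρ), inter_comm]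
    exact setLIntegral_one_sub_norm_rpow_le ht1 hρ
  calc _ ≤ ∫⁻ z in unitDisk, (∑' j : ℕ, (V (A * 2 ^ (j + 1))).indicator W z * ENNReal.ofReal (o j) +
        ∑' j : ℕ, (V (A / 2 ^ j)).indicator W z * ENNReal.ofReal (i j)) :=
        setLIntegral_mono' measurableSet_unitDisk hpt
    _ = ∑' j : ℕ, (∫⁻ z in unitDisk, (V (A * 2 ^ (j + 1))).indicator W z) * ENNReal.ofReal (o j) +
        ∑' j : ℕ, (∫⁻ z in unitDisk, (V (A / 2 ^ j)).indicator W z) * ENNReal.ofReal (i j) := by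
        rw [lintegral_add_left (Measurable.tsum fun j =>
            (hWm.indicator (hVm _)).mul_const _),
          lintegral_tsum fun j => ((hWm.indicator (hVm _)).mul_const _).aemeasurable,
          lintegral_tsum fun j => ((hWm.indicator (hVm _)).mul_const _).aemeasurable]
        congr 1 <;> refine tsum_congr fun j => ?_ <;>
          rw [lintegral_mul_const' _ _ ENNReal.ofReal_ne_top]
    _ ≤ ∑' j : ℕ, ENNReal.ofReal (c * 2 ^ (p + s)) * ENNReal.ofReal (A ^ (-s)) *
          ENNReal.ofReal (q ^ j) +
        ∑' j : ℕ, ENNReal.ofReal (c * 2 ^ p) * ENNReal.ofReal (A ^ (-s)) *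
          ENNReal.ofReal (q ^ j) := by
        refine add_le_add (ENNReal.tsum_le_tsum fun j => ?_) (ENNReal.tsum_le_tsum fun j => ?_)
        · refine (mul_le_mul_left (hVint _ (by positivity)) _).trans (le_of_eq ?_)
          rw [← ENNReal.ofReal_mul (by positivity), ← ENNReal.ofReal_mul (by positivity),
            ← ENNReal.ofReal_mul (by positivity)]
          congr 1
          rw [show A * 2 ^ (j + 1) = (A * 2 ^ j) * 2 by rw [pow_succ]; ring,
            show t + 2 = p + s by rw [ht]; ring, Real.mul_rpow (by positivity) (by norm_num), ho,
            hqpow]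
          have e : (A * 2 ^ j) ^ (p + s) * ((A * 2 ^ j) ^ (-p) * (A * 2 ^ j) ^ (-(2 * s))) =
              A ^ (-s) * (2 ^ j) ^ (-s) := by
            rw [← Real.rpow_add (by positivity), ← Real.rpow_add (by positivity),
              ← Real.mul_rpow hA.le (by positivity)]
            congr 1; ring
          linear_combination (c * 2 ^ (p + s)) * e
        · refine (mul_le_mul_left (hVint _ (by positivity)) _).trans (le_of_eq ?_)
          rw [← ENNReal.ofReal_mul (by positivity), ← ENNReal.ofReal_mul (by positivity),
            ← ENNReal.ofReal_mul (by positivity)]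
          congr 1
          rw [show t + 2 = p + s by rw [ht]; ring, hi, hqpow]
          have e0 : A / 2 ^ (j + 1) = (A / 2 ^ j) * 2⁻¹ := by rw [pow_succ]; field_simp
          have e1 : (A / 2 ^ (j + 1)) ^ (-p) = (A / 2 ^ j) ^ (-p) * 2 ^ p := by
            rw [e0, Real.mul_rpow (by positivity) (by norm_num), Real.inv_rpow (by norm_num),
              ← Real.rpow_neg (by norm_num), neg_neg]
          have e2 : (A / 2 ^ j) ^ (p + s) * (A / 2 ^ j) ^ (-p) = A ^ s * (2 ^ j) ^ (-s) := by
            rw [← Real.rpow_add (by positivity), add_neg_cancel_comm, Real.div_rpow hA.le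
              (by positivity), Real.rpow_neg (by positivity), div_eq_mul_inv]
          have e3 : A ^ s * A ^ (-(2 * s)) = A ^ (-s) := by
            rw [← Real.rpow_add hA]; congr 1; ring
          simp only [e1]
          linear_combination (c * 2 ^ p * A ^ (-(2 * s))) * e2 + (c * 2 ^ p * (2 ^ j) ^ (-s)) * e3
    _ = _ := by
        rw [ENNReal.tsum_mul_left, ENNReal.tsum_mul_left, ← hS, hD]
        ring

lemma exists_unit_direction (b : ℂ) : ∃ β : ℂ, ‖β‖ = 1 ∧ b = (‖b‖ : ℂ) * β := by
  by_cases h : b = 0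
  · exact ⟨1, by simp, by simp [h]⟩
  · have : (‖b‖ : ℂ) ≠ 0 := by simpa using h
    exact ⟨b / ‖b‖, by simp [h], by field_simp⟩

lemma one_sub_norm_le_norm_one_sub_conj_mul {b z : ℂ} (hz : ‖z‖ < 1) :
    1 - ‖b‖ ≤ ‖1 - (starRingEnd ℂ) b * z‖ := by
  have h2 := norm_sub_norm_le (1 : ℂ) ((starRingEnd ℂ) b * z)
  rw [norm_one, norm_mul, RCLike.norm_conj] at h2
  nlinarith [norm_nonneg b]

/-- Moving the pole to the circle along its radius changes the kernel by at most `1 - |b|`, itself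
at most `|1 - conj b * z|`. -/
lemma norm_sub_le_two_mul_norm_one_sub_conj_mul {b β z : ℂ} (hb : ‖b‖ < 1) (hz : ‖z‖ < 1)
    (hβ : ‖β‖ = 1) (hbβ : b = (‖b‖ : ℂ) * β) :
    ‖z - β‖ ≤ 2 * ‖1 - (starRingEnd ℂ) b * z‖ := by
  have h1 := one_sub_norm_le_norm_one_sub_conj_mul (b := b) hz
  have hββ : (starRingEnd ℂ) β * β = 1 := by rw [Complex.conj_mul', hβ]; simp
  have hconj : (starRingEnd ℂ) b = (‖b‖ : ℂ) * (starRingEnd ℂ) β := by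
    conv_lhs => rw [hbβ, map_mul, Complex.conj_ofReal]
  have e : z - β = -β * ((1 - (starRingEnd ℂ) b * z) -
      ((1 - ‖b‖ : ℝ) : ℂ) * ((starRingEnd ℂ) β * z)) := by
    rw [hconj]
    push_cast
    linear_combination (-z) * hββ
  rw [e, norm_mul, norm_neg, hβ, one_mul]
  refine (norm_sub_le _ _).trans ?_
  rw [norm_mul, norm_mul, RCLike.norm_conj, hβ, one_mul, Complex.norm_real,
    Real.norm_of_nonneg (by linarith)]
  nlinarith [norm_nonneg z]

/-- Replacing the larger of the two distances by the smaller only increases the product. This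
reduces an integral with two poles to two integrals with one pole each, uniformly in their relative
position. -/
lemma rpow_neg_mul_rpow_neg_le_add {A x y p r : ℝ} (hA : 0 < A) (hx : 0 < x) (hy : 0 < y)
    (hp : 0 < p) (hr : 0 < r) :
    y ^ (-p) * (A + x) ^ (-r) ≤ x ^ (-p) * (A + x) ^ (-r) + y ^ (-p) * (A + y) ^ (-r) := by
  rcases le_total x y with h | h
  · have h1 : y ^ (-p) ≤ x ^ (-p) := Real.rpow_le_rpow_of_nonpos hx h (by linarith)
    have h2 : y ^ (-p) * (A + x) ^ (-r) ≤ x ^ (-p) * (A + x) ^ (-r) := by gcongr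
    have h3 : 0 ≤ y ^ (-p) * (A + y) ^ (-r) := by positivity
    linarith
  · have h1 : (A + x) ^ (-r) ≤ (A + y) ^ (-r) :=
      Real.rpow_le_rpow_of_nonpos (by positivity) (by linarith) (by linarith)
    have h2 : y ^ (-p) * (A + x) ^ (-r) ≤ y ^ (-p) * (A + y) ^ (-r) := by gcongr
    have h3 : 0 ≤ x ^ (-p) * (A + x) ^ (-r) := by positivity
    linarith

lemma rpow_mul_fWeight_le {p s : ℝ} (hp : 0 < p) (hs : 0 < s) {a b α β z : ℂ} (ha : ‖a‖ < 1)
    (hb : ‖b‖ < 1) (hz : ‖z‖ < 1) (hα : ‖α‖ = 1) (hβ : ‖β‖ = 1) (haα : a = (‖a‖ : ℂ) * α)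
    (hbβ : b = (‖b‖ : ℂ) * β) :
    ‖1 - (starRingEnd ℂ) b * z‖ ^ (-p) * fWeight p s a z ≤
      2 ^ p * 2 ^ |p - 2 + s| * 2 ^ s * 3 ^ (2 * s) * (1 - ‖a‖) ^ s *
        ((1 - ‖z‖) ^ (p - 2 + s) *
          (‖z - α‖ ^ (-p) * ((1 - ‖a‖) + ‖z - α‖) ^ (-(2 * s))) +
        (1 - ‖z‖) ^ (p - 2 + s) *
          (‖z - β‖ ^ (-p) * ((1 - ‖a‖) + ‖z - β‖) ^ (-(2 * s)))) := by
  have hne : ∀ γ : ℂ, ‖γ‖ = 1 → 0 < ‖z - γ‖ := fun γ hγ =>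
    norm_pos_iff.mpr (sub_ne_zero.mpr fun h => by rw [h, hγ] at hz; exact lt_irrefl _ hz)
  have hx := hne α hα
  have hy := hne β hβ
  have hA : 0 < 1 - ‖a‖ := by linarith
  have hz0 : 0 < 1 - ‖z‖ := by linarith
  have hu := norm_one_sub_conj_mul_pos hb hz
  have hv := norm_one_sub_conj_mul_pos ha hz
  set A := 1 - ‖a‖ with hAdef
  have h1 : ‖1 - (starRingEnd ℂ) b * z‖ ^ (-p) ≤ 2 ^ p * ‖z - β‖ ^ (-p) := by
    have := norm_sub_le_two_mul_norm_one_sub_conj_mul hb hz hβ hbβ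
    have h : (‖z - β‖ / 2) ^ (-p) ≥ ‖1 - (starRingEnd ℂ) b * z‖ ^ (-p) :=
      Real.rpow_le_rpow_of_nonpos (by positivity) (by linarith) (by linarith)
    refine h.trans (le_of_eq ?_)
    rw [Real.div_rpow hy.le (by norm_num), Real.rpow_neg (by norm_num : (0:ℝ) ≤ 2), div_inv_eq_mul,
      mul_comm]
  have h2 : ‖1 - (starRingEnd ℂ) a * z‖ ^ (-(2 * s)) ≤
      3 ^ (2 * s) * (A + ‖z - α‖) ^ (-(2 * s)) := by
    have e1 := norm_sub_le_two_mul_norm_one_sub_conj_mul ha hz hα haα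
    have e2 := one_sub_norm_le_norm_one_sub_conj_mul (b := a) hz
    have h : ((A + ‖z - α‖) / 3) ^ (-(2 * s)) ≥ ‖1 - (starRingEnd ℂ) a * z‖ ^ (-(2 * s)) :=
      Real.rpow_le_rpow_of_nonpos (by positivity) (by linarith) (by linarith)
    refine h.trans (le_of_eq ?_)
    rw [Real.div_rpow (by positivity) (by norm_num), Real.rpow_neg (by norm_num : (0:ℝ) ≤ 3),
      div_inv_eq_mul, mul_comm]
  have hn := norm_nonneg z
  have hna := norm_nonneg a
  have hz2 : 0 < 1 - ‖z‖ ^ 2 := by nlinarith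
  have ha2 : 0 < 1 - ‖a‖ ^ 2 := by nlinarith
  have h3 : (1 - ‖z‖ ^ 2) ^ (p - 2 + s) ≤ 2 ^ |p - 2 + s| * (1 - ‖z‖) ^ (p - 2 + s) :=
    Real.rpow_le_mul_rpow_of_comparable _ hz2 hz0 (by norm_num) (by nlinarith) (by nlinarith)
  have h4 : (1 - ‖a‖ ^ 2) ^ s ≤ 2 ^ s * A ^ s := by
    rw [← Real.mul_rpow (by norm_num) hA.le]
    exact Real.rpow_le_rpow ha2.le (by nlinarith) hs.le
  have hw : fWeight p s a z = (1 - ‖z‖ ^ 2) ^ (p - 2 + s) * (1 - ‖a‖ ^ 2) ^ s *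
      ‖1 - (starRingEnd ℂ) a * z‖ ^ (-(2 * s)) := by
    rw [fWeight, one_sub_norm_moebius_sq ha hz, Real.div_rpow (by positivity) (by positivity),
      Real.mul_rpow ha2.le hz2.le, Real.rpow_add hz2, Real.rpow_neg hv.le, Real.rpow_mul hv.le]
    simp only [Real.rpow_two]
    field_simp
  have h5 := rpow_neg_mul_rpow_neg_le_add hA hx hy hp (by positivity : 0 < 2 * s)
  rw [hw]
  calc ‖1 - (starRingEnd ℂ) b * z‖ ^ (-p) * ((1 - ‖z‖ ^ 2) ^ (p - 2 + s) * (1 - ‖a‖ ^ 2) ^ s *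
        ‖1 - (starRingEnd ℂ) a * z‖ ^ (-(2 * s)))
      ≤ (2 ^ p * ‖z - β‖ ^ (-p)) * ((2 ^ |p - 2 + s| * (1 - ‖z‖) ^ (p - 2 + s)) * (2 ^ s * A ^ s) *
        (3 ^ (2 * s) * (A + ‖z - α‖) ^ (-(2 * s)))) := by gcongr
    _ = 2 ^ p * 2 ^ |p - 2 + s| * 2 ^ s * 3 ^ (2 * s) * A ^ s * ((1 - ‖z‖) ^ (p - 2 + s) *
        (‖z - β‖ ^ (-p) * (A + ‖z - α‖) ^ (-(2 * s)))) := by ring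
    _ ≤ _ := by
        gcongr
        rw [← mul_add]
        gcongr

/-- Functions whose derivative is dominated by a fractional linear kernel have bounded energy. -/
lemma exists_energyLE_of_deriv_le {p s : ℝ} (hp : 0 < p) (hs : 0 < s) (hsp : 1 < s + p) {K : ℝ}
    (hK : 0 ≤ K) : ∃ E : ℝ≥0, ∀ (f : ℂ → ℂ) (b : ℂ), ‖b‖ < 1 →
      (∀ z : ℂ, ‖z‖ < 1 → ‖deriv f z‖ ≤ K / ‖1 - (starRingEnd ℂ) b * z‖) → EnergyLE p s f E := by
  obtain ⟨C, hC⟩ := exists_singular_integral_le hp hs hsp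
  set L : ℝ := K ^ p * (2 ^ p * 2 ^ |p - 2 + s| * 2 ^ s * 3 ^ (2 * s)) with hL
  have hL0 : 0 ≤ L := by positivity
  refine ⟨(Real.pi⁻¹).toNNReal * (L.toNNReal * (C + C)), fun f b hb hf a ha => ?_⟩
  rw [mem_unitDisk] at ha
  obtain ⟨α, hα, haα⟩ := exists_unit_direction a
  obtain ⟨β, hβ, hbβ⟩ := exists_unit_direction b
  have hA : 0 < 1 - ‖a‖ := by linarith
  rw [areaMeasure, Measure.restrict_smul, lintegral_smul_measure, smul_eq_mul, ENNReal.coe_mul]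
  refine mul_le_mul_right ?_ _
  set Φ : ℂ → ℂ → ℝ≥0∞ := fun γ z => ENNReal.ofReal ((1 - ‖z‖) ^ (p - 2 + s)) *
    ENNReal.ofReal (‖z - γ‖ ^ (-p) * ((1 - ‖a‖) + ‖z - γ‖) ^ (-(2 * s))) with hΦ
  have hpt : ∀ z ∈ unitDisk, ‖deriv f z‖ₑ ^ p * ENNReal.ofReal (fWeight p s a z) ≤
      ENNReal.ofReal (L * (1 - ‖a‖) ^ s) * (Φ α z + Φ β z) := fun z hz => by
    rw [mem_unitDisk] at hz
    have hz0 : 0 < 1 - ‖z‖ := by linarith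
    have hu := norm_one_sub_conj_mul_pos hb hz
    have e : ‖deriv f z‖ₑ ^ p = ENNReal.ofReal (‖deriv f z‖ ^ p) := by
      rw [← ENNReal.ofReal_rpow_of_nonneg (norm_nonneg _) hp.le, ofReal_norm]
    have hw0 : 0 ≤ fWeight p s a z := by
      have h1 : 0 ≤ 1 - ‖z‖ ^ 2 := by nlinarith [norm_nonneg z]
      have h2 : 0 ≤ 1 - ‖a‖ ^ 2 := by nlinarith [norm_nonneg a]
      rw [fWeight, one_sub_norm_moebius_sq ha hz]
      exact mul_nonneg (Real.rpow_nonneg h1 _) (Real.rpow_nonneg (by positivity) _)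
    rw [e, hΦ, ← ENNReal.ofReal_mul (by positivity)]
    simp only
    rw [← ENNReal.ofReal_mul (by positivity), ← ENNReal.ofReal_mul (by positivity),
      ← ENNReal.ofReal_add (by positivity) (by positivity), ← ENNReal.ofReal_mul (by positivity)]
    refine ENNReal.ofReal_le_ofReal ?_
    calc ‖deriv f z‖ ^ p * fWeight p s a z
        ≤ (K ^ p * ‖1 - (starRingEnd ℂ) b * z‖ ^ (-p)) * fWeight p s a z := by
          gcongr
          refine (Real.rpow_le_rpow (norm_nonneg _) (hf z hz) hp.le).trans (le_of_eq ?_)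
          rw [Real.div_rpow hK hu.le, Real.rpow_neg hu.le, div_eq_mul_inv]
      _ = K ^ p * (‖1 - (starRingEnd ℂ) b * z‖ ^ (-p) * fWeight p s a z) := mul_assoc _ _ _
      _ ≤ _ := by
          refine (mul_le_mul_of_nonneg_left
            (rpow_mul_fWeight_le hp hs ha hb hz hα hβ haα hbβ) (by positivity)).trans (le_of_eq ?_)
          rw [hL]; ring
  have hΦm : ∀ γ, Measurable (Φ γ) := fun γ => by fun_prop
  calc _ ≤ ∫⁻ z in unitDisk, ENNReal.ofReal (L * (1 - ‖a‖) ^ s) * (Φ α z + Φ β z) :=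
        setLIntegral_mono' measurableSet_unitDisk hpt
    _ = ENNReal.ofReal (L * (1 - ‖a‖) ^ s) *
          ((∫⁻ z in unitDisk, Φ α z) + ∫⁻ z in unitDisk, Φ β z) := by
        rw [lintegral_const_mul' _ _ ENNReal.ofReal_ne_top, lintegral_add_left (hΦm α)]
    _ ≤ ENNReal.ofReal (L * (1 - ‖a‖) ^ s) * (C * ENNReal.ofReal ((1 - ‖a‖) ^ (-s)) +
          C * ENNReal.ofReal ((1 - ‖a‖) ^ (-s))) := by
        gcongr
        exacts [hC _ hA α hα, hC _ hA β hβ]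
    -- The factor `(1 - |a|) ^ s` of the Möbius weight cancels the `A ^ (-s)` of the singular
    -- integral, which makes the bound independent of `a` and `b`.
    _ = ENNReal.ofReal L * (C + C) *
          (ENNReal.ofReal ((1 - ‖a‖) ^ s) * ENNReal.ofReal ((1 - ‖a‖) ^ (-s))) := by
        rw [ENNReal.ofReal_mul hL0]; ring
    _ = _ := by
        rw [← ENNReal.ofReal_mul (by positivity), ← Real.rpow_add hA, add_neg_cancel,
          Real.rpow_zero, ENNReal.ofReal_one, mul_one, ENNReal.coe_mul, ENNReal.coe_add]
        rfl

/-! ### Logarithmic test functions. -/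

lemma norm_clog_le {w : ℂ} {c : ℝ} (hc : 0 < c) (hc1 : c ≤ 1) (hcw : c ≤ ‖w‖) (hw : ‖w‖ ≤ 2) :
    ‖Complex.log w‖ ≤ Real.log (2 / c) + Real.pi := by
  refine (Complex.norm_le_abs_re_add_abs_im _).trans ?_
  rw [Complex.log_re, Complex.log_im]
  have hw0 : 0 < ‖w‖ := hc.trans_le hcw
  refine add_le_add (abs_le.mpr ⟨?_, ?_⟩) (Complex.abs_arg_le_pi w)
  · rw [neg_le, ← Real.log_inv]
    refine Real.log_le_log (by positivity) ?_
    rw [inv_eq_one_div]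
    gcongr
    norm_num
  · refine Real.log_le_log (by positivity) (hw.trans ?_)
    rw [le_div_iff₀ hc]
    linarith

/-- The logarithmic test function with pole direction `b`. -/
noncomputable def logTest (h : ℝ) (b z : ℂ) : ℂ :=
  Complex.log (1 - (starRingEnd ℂ) b * z) ^ 2 / (Real.log (2 / h) : ℂ)

lemma hasDerivAt_logTest (h : ℝ) {b z : ℂ} (hb : ‖b‖ < 1) (hz : ‖z‖ < 1) :
    HasDerivAt (logTest h b) (2 * Complex.log (1 - (starRingEnd ℂ) b * z) *
      (-(starRingEnd ℂ) b / (1 - (starRingEnd ℂ) b * z)) / (Real.log (2 / h) : ℂ)) z := by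
  have hlt : ‖(starRingEnd ℂ) b * z‖ < 1 := by
    rw [norm_mul, RCLike.norm_conj]
    exact mul_lt_one_of_nonneg_of_lt_one_left (norm_nonneg _) hb hz.le
  have hslit : 1 - (starRingEnd ℂ) b * z ∈ Complex.slitPlane := by
    refine Or.inl ?_
    have := (Complex.re_le_norm ((starRingEnd ℂ) b * z))
    rw [Complex.sub_re, Complex.one_re]
    linarith
  have h1 : HasDerivAt (fun z => 1 - (starRingEnd ℂ) b * z) (-(starRingEnd ℂ) b) z := by
    simpa using ((hasDerivAt_id z).const_mul ((starRingEnd ℂ) b)).const_sub 1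
  have h2 := ((h1.clog hslit).pow 2).div_const (Real.log (2 / h) : ℂ)
  refine h2.congr_deriv ?_
  simp

lemma norm_one_sub_conj_mul_le_two {b z : ℂ} (hb : ‖b‖ < 1) (hz : ‖z‖ < 1) :
    ‖1 - (starRingEnd ℂ) b * z‖ ≤ 2 := by
  refine (norm_sub_le _ _).trans ?_
  rw [norm_one, norm_mul, RCLike.norm_conj]
  nlinarith [norm_nonneg z, norm_nonneg b]

/-- Differentiating the square leaves one logarithm, of size at most `log (2 / h) + π` because `|1 -
conj b * z| ≥ h`; the normalizing denominator cancels it. -/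
lemma norm_deriv_logTest_le {h : ℝ} (h0 : 0 < h) (h1 : h ≤ 1) {b z : ℂ} (hb : ‖b‖ = 1 - h)
    (hz : ‖z‖ < 1) : ‖deriv (logTest h b) z‖ ≤
      2 * (1 + Real.pi / Real.log 2) / ‖1 - (starRingEnd ℂ) b * z‖ := by
  have hb1 : ‖b‖ < 1 := by linarith
  have hl2 : 0 < Real.log 2 := Real.log_pos (by norm_num)
  have hlog := log_two_le_log_two_div h0 h1
  have hlogpos := log_two_div_pos h0 h1
  have hu := norm_one_sub_conj_mul_pos hb1 hz
  rw [(hasDerivAt_logTest h hb1 hz).deriv, norm_div, norm_mul, norm_mul, norm_div, norm_neg,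
    RCLike.norm_conj, Complex.norm_real, Real.norm_of_nonneg hlogpos.le, Complex.norm_two,
    div_le_iff₀ hlogpos]
  have h2 := norm_clog_le (w := 1 - (starRingEnd ℂ) b * z) h0 h1
    (by have := one_sub_norm_le_norm_one_sub_conj_mul (b := b) hz
        linarith) (norm_one_sub_conj_mul_le_two hb1 hz)
  have h3 : Real.log (2 / h) + Real.pi ≤ (1 + Real.pi / Real.log 2) * Real.log (2 / h) := by
    have : Real.pi ≤ Real.pi / Real.log 2 * Real.log (2 / h) := by
      rw [div_mul_eq_mul_div, le_div_iff₀ hl2]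
      have := Real.pi_pos
      gcongr
    linarith
  have hpi := Real.pi_pos
  calc 2 * ‖Complex.log (1 - (starRingEnd ℂ) b * z)‖ * (‖b‖ / ‖1 - (starRingEnd ℂ) b * z‖)
      ≤ 2 * ((1 + Real.pi / Real.log 2) * Real.log (2 / h)) *
        (1 / ‖1 - (starRingEnd ℂ) b * z‖) := by
        gcongr
        exact h2.trans h3
    _ = _ := by ring

lemma norm_logTest (h : ℝ) (h0 : 0 < h) (h1 : h ≤ 1) (b z : ℂ) :
    ‖logTest h b z‖ = ‖Complex.log (1 - (starRingEnd ℂ) b * z)‖ ^ 2 / Real.log (2 / h) := by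
  rw [logTest, norm_div, norm_pow, Complex.norm_real,
    Real.norm_of_nonneg (log_two_div_pos h0 h1).le]

lemma log_le_norm_logTest {h θ : ℝ} (h0 : 0 < h) (h1 : h ≤ 1 / 200) {z : ℂ}
    (hz : z ∈ carlesonBox θ h) :
    Real.log (2 / h) / 4 ≤
      ‖logTest h (((1 - h : ℝ) : ℂ) * Complex.exp (θ * Complex.I)) z‖ := by
  set u := Complex.exp (θ * Complex.I) with hu
  have hun : ‖u‖ = 1 := Complex.norm_exp_ofReal_mul_I θ
  have hlog := log_two_div_pos h0 (by linarith : h ≤ 1)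
  have hz0 : z ≠ 0 := norm_pos_iff.mp (by linarith [hz.1])
  have hn : (‖z‖ : ℂ) ≠ 0 := by simpa using hz0
  have hbn : ‖((1 - h : ℝ) : ℂ) * u‖ = 1 - h := norm_ofReal_mul_of_norm_eq_one hun (by linarith)
  have hpos := norm_one_sub_conj_mul_pos (a := ((1 - h : ℝ) : ℂ) * u) (z := z)
    (by rw [hbn]; linarith) hz.2.1
  have hle : ‖1 - (starRingEnd ℂ) (((1 - h : ℝ) : ℂ) * u) * z‖ ≤ 9 * h := by
    have huu : (starRingEnd ℂ) u * u = 1 := by rw [Complex.conj_mul', hun]; simp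
    have e : 1 - (starRingEnd ℂ) (((1 - h : ℝ) : ℂ) * u) * z =
        ((1 - (1 - h) * ‖z‖ : ℝ) : ℂ) - (starRingEnd ℂ) u *
          (((1 - h) * ‖z‖ : ℝ) : ℂ) * (z / (‖z‖ : ℂ) - u) := by
      rw [map_mul, Complex.conj_ofReal]
      push_cast
      field_simp
      linear_combination (-(1 - (h : ℂ)) * ‖z‖) * huu
    rw [e]
    refine (norm_sub_le _ _).trans ?_
    have hh : 0 ≤ (1 - h) * ‖z‖ := mul_nonneg (by linarith) (norm_nonneg z)
    have hh1 : (1 - h) * ‖z‖ ≤ 1 := by nlinarith [hz.2.1, norm_nonneg z]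
    rw [norm_mul, norm_mul, RCLike.norm_conj, hun, one_mul, Complex.norm_real, Complex.norm_real,
      Real.norm_of_nonneg (by linarith), Real.norm_of_nonneg hh]
    have h2 := norm_sub_le_of_mem_circleArc hz.2.2
    have h3 : (1 - h) * ‖z‖ * ‖z / (‖z‖ : ℂ) - u‖ ≤ 1 * (2 * Real.pi * h) := by gcongr
    have h4 : 1 - (1 - h) * ‖z‖ ≤ 2 * h := by nlinarith [hz.1]
    have h5 : Real.pi * h ≤ 3.15 * h := by gcongr; exact Real.pi_lt_d2.le
    linarith
  have hlogle : Real.log (2 / h) / 2 ≤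
      ‖Complex.log (1 - (starRingEnd ℂ) (((1 - h : ℝ) : ℂ) * u) * z)‖ := by
    refine le_trans ?_ (Complex.abs_re_le_norm _)
    rw [Complex.log_re]
    refine le_trans ?_ (neg_le_abs _)
    have h6 : Real.log ‖1 - (starRingEnd ℂ) (((1 - h : ℝ) : ℂ) * u) * z‖ ≤ Real.log (9 * h) :=
      Real.log_le_log hpos hle
    -- This amounts to `162 h ≤ 1`, whence the assumption `h ≤ 1 / 200`.
    have h7 : Real.log (2 / h) ≤ Real.log (((9 * h)⁻¹) ^ 2) := by
      refine Real.log_le_log (by positivity) ?_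
      rw [inv_pow, div_le_iff₀ h0, inv_mul_eq_div, le_div_iff₀ (by positivity)]
      nlinarith
    rw [Real.log_pow, Real.log_inv] at h7
    push_cast at h7
    linarith
  rw [norm_logTest h h0 (by linarith), le_div_iff₀ hlog]
  nlinarith

/-- At a fixed `z` the numerator is bounded uniformly in `b`, while `log (2 / h)` tends to infinity.
-/
lemma tendsto_logTest_zero {h : ℕ → ℝ} {b : ℕ → ℂ} (hlim : Tendsto h atTop (𝓝[>] 0))
    (h1 : ∀ n, h n ≤ 1) (h0 : ∀ n, 0 < h n) (hb : ∀ n, ‖b n‖ < 1) {z : ℂ} (hz : ‖z‖ < 1) :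
    Tendsto (fun n => logTest (h n) (b n) z) atTop (𝓝 0) := by
  have hz0 : 0 < 1 - ‖z‖ := by linarith
  set M : ℝ := (Real.log (2 / (1 - ‖z‖)) + Real.pi) ^ 2 with hM
  have hlog : Tendsto (fun n => Real.log (2 / h n)) atTop atTop := by
    refine Real.tendsto_log_atTop.comp ?_
    simp_rw [div_eq_mul_inv]
    exact (tendsto_inv_nhdsGT_zero.comp hlim).const_mul_atTop (by norm_num)
  have hM0 : Tendsto (fun n => M / Real.log (2 / h n)) atTop (𝓝 0) :=
    tendsto_const_nhds.div_atTop hlog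
  refine squeeze_zero_norm (fun n => ?_) hM0
  have hlogn := log_two_div_pos (h0 n) (h1 n)
  rw [norm_logTest _ (h0 n) (h1 n)]
  refine div_le_div_of_nonneg_right (pow_le_pow_left₀ (norm_nonneg _) ?_ 2) hlogn.le
  refine norm_clog_le hz0 (by linarith [norm_nonneg z]) ?_ (norm_one_sub_conj_mul_le_two (hb n) hz)
  have h2 := norm_sub_norm_le (1 : ℂ) ((starRingEnd ℂ) (b n) * z)
  rw [norm_one, norm_mul, RCLike.norm_conj] at h2
  nlinarith [norm_nonneg z, hb n]

/-! ### Necessity: identifying the limit and contradicting compactness. -/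

lemma mem_circleArc_one {ζ : ℂ} (hζ : ‖ζ‖ = 1) : ζ ∈ circleArc 0 1 := by
  have e : Complex.exp (ζ.arg * Complex.I) = ζ := by
    have := Complex.norm_mul_exp_arg_mul_I ζ
    rwa [hζ, Complex.ofReal_one, one_mul] at this
  have hpi := Real.pi_pos
  have h1 := Complex.neg_pi_lt_arg ζ
  have h2 := Complex.arg_le_pi ζ
  rcases le_total 0 ζ.arg with h | h
  · exact ⟨ζ.arg, ⟨h, by linarith⟩, e⟩
  · refine ⟨ζ.arg + 2 * Real.pi, ⟨by linarith, by linarith⟩, ?_⟩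
    simp only
    push_cast
    rw [add_mul, Complex.exp_add, e, Complex.exp_two_pi_mul_I, mul_one]

/-- The box over the full circle is the punctured disk. No box contains the origin, so vanishing
almost everywhere there is all that the tent norm can see. -/
lemma carlesonBox_subset_carlesonBox_one {θ h : ℝ} (h1 : h ≤ 1) :
    carlesonBox θ h ⊆ carlesonBox 0 1 := fun z hz => by
  have hz0 : 0 < ‖z‖ := by linarith [hz.1]
  exact ⟨by linarith, hz.2.1, mem_circleArc_one (by simp [norm_pos_iff.mp hz0])⟩

lemma le_tentNorm_rpow {p : ℝ} (hp : 0 < p) (s : ℝ) (μ : Measure ℂ) (f : ℂ → ℂ) (θ : ℝ) {h : ℝ}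
    (hh : h ∈ Ioc (0 : ℝ) 1) :
    ENNReal.ofReal (h ^ (-s)) * ∫⁻ z in carlesonBox θ h, ‖f z‖ₑ ^ p ∂μ ≤
      tentNorm p s μ f ^ p := by
  rw [tentNorm, one_div, ENNReal.rpow_inv_rpow hp.ne']
  refine le_trans ?_ (le_iSup (fun θ : ℝ => ⨆ h ∈ Ioc (0 : ℝ) 1,
    ENNReal.ofReal (h ^ (-s)) * ∫⁻ z in carlesonBox θ h, ‖f z‖ₑ ^ p ∂μ) θ)
  exact le_iSup₂ (f := fun (h : ℝ) (_ : h ∈ Ioc (0 : ℝ) 1) =>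
    ENNReal.ofReal (h ^ (-s)) * ∫⁻ z in carlesonBox θ h, ‖f z‖ₑ ^ p ∂μ) h hh

/-- A sequence that tends to `0` pointwise on the disk can only have the tent space limit `0`. -/
lemma ae_eq_zero_of_tendsto_tentNorm {p s : ℝ} (hp : 0 < p) {μ : Measure ℂ} {F : ℕ → ℂ → ℂ}
    {g : ℂ → ℂ} (hF : ∀ n, AEMeasurable (F n) μ) (hg : AEMeasurable g μ)
    (hF0 : ∀ z ∈ unitDisk, Tendsto (fun n => F n z) atTop (𝓝 0))
    (hlim : Tendsto (fun n => tentNorm p s μ (fun z => F n z - g z)) atTop (𝓝 0)) :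
    ∀ᵐ z ∂μ.restrict (carlesonBox 0 1), g z = 0 := by
  have hpow : Tendsto (fun n => tentNorm p s μ (fun z => F n z - g z) ^ p) atTop (𝓝 0) := by
    have := ((ENNReal.continuous_rpow_const (y := p)).tendsto 0).comp hlim
    rwa [ENNReal.zero_rpow_of_pos hp] at this
  have hint : Tendsto (fun n => ∫⁻ z in carlesonBox 0 1, ‖F n z - g z‖ₑ ^ p ∂μ) atTop (𝓝 0) := by
    refine tendsto_of_tendsto_of_tendsto_of_le_of_le tendsto_const_nhds hpow
      (fun _ => zero_le) fun n => ?_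
    have := le_tentNorm_rpow hp s μ (fun z => F n z - g z) 0 (h := 1) ⟨by norm_num, le_rfl⟩
    simpa using this
  have hzero : ∫⁻ z in carlesonBox 0 1, ‖g z‖ₑ ^ p ∂μ = 0 := by
    refine le_antisymm ?_ zero_le
    calc ∫⁻ z in carlesonBox 0 1, ‖g z‖ₑ ^ p ∂μ
        = ∫⁻ z in carlesonBox 0 1, liminf (fun n => ‖F n z - g z‖ₑ ^ p) atTop ∂μ := by
          refine setLIntegral_congr_fun (measurableSet_carlesonBox 0 1) fun z hz => ?_
          refine (Tendsto.liminf_eq ?_).symm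
          have h1 := (hF0 z (carlesonBox_subset_unitDisk 0 1 hz)).sub_const (g z)
          rw [zero_sub] at h1
          have h2 := ((ENNReal.continuous_rpow_const (y := p)).tendsto _).comp
            ((continuous_enorm.tendsto _).comp h1)
          rwa [enorm_neg] at h2
      _ ≤ liminf (fun n => ∫⁻ z in carlesonBox 0 1, ‖F n z - g z‖ₑ ^ p ∂μ) atTop :=
          lintegral_liminf_le' fun n => (((hF n).sub hg).enorm.pow_const p).restrict
      _ = 0 := hint.liminf_eq
  rw [lintegral_eq_zero_iff' ((hg.enorm.pow_const p).restrict)] at hzero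
  filter_upwards [hzero] with z hz
  simpa [ENNReal.rpow_eq_zero_iff, hp, not_lt.mpr hp.le] using hz

/-- If the embedding is compact, then the measure is a vanishing logarithmic Carleson measure. -/
theorem IsCompactIdentity.isVanishingLogCarleson {p s : ℝ} (hp : 0 < p) (hs : 0 < s)
    (hsp : 1 < s + p) {μ : Measure ℂ} (H : IsCompactIdentity p (p - 2) s μ) :
    IsVanishingLogCarleson p s μ := by
  refine ENNReal.tendsto_nhds_zero.mpr fun ε hε => ?_
  by_contra hcon
  have hev : ∀ᶠ h : ℝ in 𝓝[>] 0, h ∈ Ioo (0 : ℝ) (1 / 200) := Ioo_mem_nhdsGT (by norm_num)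
  obtain ⟨h, hlim, hh⟩ := exists_seq_forall_of_frequently
    ((not_eventually.mp hcon).and_eventually hev)
  have h0 : ∀ n, 0 < h n := fun n => (hh n).2.1
  have h200 : ∀ n, h n ≤ 1 / 200 := fun n => (hh n).2.2.le
  have h1 : ∀ n, h n ≤ 1 := fun n => (h200 n).trans (by norm_num)
  have hθ : ∀ n, ∃ θ : ℝ, ε < ENNReal.ofReal (h n ^ (-s) * Real.log (2 / h n) ^ p) *
      μ (carlesonBox θ (h n)) := fun n => lt_iSup_iff.mp (not_le.mp (hh n).1)
  choose θ hθ using hθ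
  set b : ℕ → ℂ := fun n => ((1 - h n : ℝ) : ℂ) * Complex.exp (θ n * Complex.I) with hb
  have hbn : ∀ n, ‖b n‖ = 1 - h n := fun n =>
    norm_ofReal_mul_of_norm_eq_one (Complex.norm_exp_ofReal_mul_I _) (by linarith [h1 n])
  have hb1 : ∀ n, ‖b n‖ < 1 := fun n => by rw [hbn]; linarith [h0 n]
  set F : ℕ → ℂ → ℂ := fun n => logTest (h n) (b n) with hF
  have hFd : ∀ n, DifferentiableOn ℂ (F n) unitDisk := fun n z hz =>
    (hasDerivAt_logTest (h n) (hb1 n) (mem_unitDisk.mp hz)).differentiableAt.differentiableWithinAt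
  have hl2 : 0 < Real.log 2 := Real.log_pos (by norm_num)
  have hpi := Real.pi_pos
  obtain ⟨E, hE⟩ := exists_energyLE_of_deriv_le hp hs hsp
    (K := 2 * (1 + Real.pi / Real.log 2)) (by positivity)
  have hFE : ∀ n, fSeminorm p (p - 2) s (F n) ≤ (E : ℝ≥0∞) ^ (1 / p) := fun n =>
    (hE (F n) (b n) (hb1 n) fun z hz =>
      norm_deriv_logTest_le (h0 n) (h1 n) (hbn n) hz).fSeminorm_le hp
  have hEtop : (E : ℝ≥0∞) ^ (1 / p) ≠ ∞ :=
    ENNReal.rpow_ne_top_of_nonneg (by positivity) ENNReal.coe_ne_top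
  have hFs : ∀ n, F n ∈ fSpace p (p - 2) s := fun n => ⟨hFd n, (hFE n).trans_lt hEtop.lt_top⟩
  obtain ⟨g, hg, k, hk, hconv⟩ := H.2 F hFs ⟨((E : ℝ≥0∞) ^ (1 / p)).toNNReal, fun n => by
    rw [ENNReal.coe_toNNReal hEtop, fNorm]
    have : F n 0 = 0 := by simp [hF, logTest]
    rw [this, enorm_zero, zero_add]
    exact hFE n⟩
  have hg0 := ae_eq_zero_of_tendsto_tentNorm hp (fun n => (H.1 (hFs (k n))).1) hg.1
    (fun z hz => (tendsto_logTest_zero hlim h1 h0 hb1 (mem_unitDisk.mp hz)).comp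
      hk.tendsto_atTop) hconv
  have hpow : Tendsto (fun n => tentNorm p s μ (fun z => F (k n) z - g z) ^ p) atTop (𝓝 0) := by
    have := ((ENNReal.continuous_rpow_const (y := p)).tendsto 0).comp hconv
    rwa [ENNReal.zero_rpow_of_pos hp] at this
  set c : ℝ≥0∞ := ENNReal.ofReal ((1 / 4) ^ p) with hc
  have hcpos : 0 < c := ENNReal.ofReal_pos.mpr (by positivity)
  -- Evaluate the norm on the bad box of the same index: there `g` vanishes almost everywhere and
  -- the test function is at least `log (2 / h) / 4`, which reproduces the violated Carleson
  -- quantity up to `(1 / 4) ^ p`.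
  have hlow : ∀ n, c * ε ≤ tentNorm p s μ (fun z => F (k n) z - g z) ^ p := fun n => by
    set m := k n
    have hlog := log_two_div_pos (h0 m) (h1 m)
    refine le_trans ?_ (le_tentNorm_rpow hp s μ _ (θ m) ⟨h0 m, h1 m⟩)
    calc c * ε ≤ c * (ENNReal.ofReal (h m ^ (-s) * Real.log (2 / h m) ^ p) *
          μ (carlesonBox (θ m) (h m))) := mul_le_mul_right (hθ m).le _
      _ = ENNReal.ofReal (h m ^ (-s)) *
          ∫⁻ z in carlesonBox (θ m) (h m), ENNReal.ofReal (Real.log (2 / h m) / 4) ^ p ∂μ := by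
          have h0m := h0 m
          rw [setLIntegral_const, ENNReal.ofReal_rpow_of_nonneg (by positivity) hp.le,
            div_eq_mul_one_div (Real.log (2 / h m)) 4, Real.mul_rpow hlog.le (by norm_num),
            ENNReal.ofReal_mul (by positivity), ENNReal.ofReal_mul (by positivity)]
          ring
      _ ≤ ENNReal.ofReal (h m ^ (-s)) * ∫⁻ z in carlesonBox (θ m) (h m), ‖F m z‖ₑ ^ p ∂μ := by
          refine mul_le_mul_right (setLIntegral_mono' (measurableSet_carlesonBox _ _)
            fun z hz => ENNReal.rpow_le_rpow ?_ hp.le) _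
          rw [← ofReal_norm]
          exact ENNReal.ofReal_le_ofReal (log_le_norm_logTest (h0 m) (h200 m) hz)
      _ = _ := by
          congr 1
          refine lintegral_congr_ae ?_
          filter_upwards [ae_restrict_of_ae_restrict_of_subset
            (carlesonBox_subset_carlesonBox_one (h1 m)) hg0] with z hz
          rw [hz, sub_zero]
  have hle : c * ε ≤ 0 := ge_of_tendsto' hpow hlow
  exact absurd hle (not_le.mpr (ENNReal.mul_pos hcpos.ne' hε.ne'))

theorem corollary11 (p s : ℝ) (hp : 0 < p) (hs : 0 < s) (hsp : 1 < s + p)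
    (μ : Measure ℂ) (hμD : μ unitDiskᶜ = 0)
    (hμfin : ∀ K : Set ℂ, IsCompact K → K ⊆ unitDisk → μ K < ∞)
    (hμeval : PointEvaluationsBounded p s μ) :
    IsCompactIdentity p (p - 2) s μ ↔ IsVanishingLogCarleson p s μ :=
  ⟨fun H => H.isVanishingLogCarleson hp hs hsp, fun H => H.isCompactIdentity hp hs hμD hμfin⟩
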